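/- **Theorem (Exact representation of a $k$-th order smooth function as a linear combination of $\le k$-th order splines).** *Notation.* Let $d\ge 0$ and $k\ge 1$ be integers. For $s\subset\{1,\dots,d\}$ and $x\in[0,1]^d$ write $x(s)=(x_i)_{i\in s}$, and let $(x(s),0(-s))$ be $x$ with the coordinates outside $s$ set to $0$; $(a,b]$ denotes the box $\prod_i(a_i,b_i]$ and $\mu$ Lebesgue measure. Let $\mathcal S^{n}(d)$ be the set of $\bar s(n)=(s_1,\dots,s_{n})$ with $s_{n}\subset\dots\subset s_1\subset\{1,\dots,d\}$ (empty sets allowed), and $\bar s(j)=(s_1,\dots,s_j)$. If $s_{k+1}=\emptyset$, let $m=m(\bar s(k+1))\in\{0,\dots,k\}$ be the smallest $m$ with $s_{m+1}=\emptyset$. *Measures and variation.* For $f:[0,1]^s\to\mathbb R$ let $\Delta_{(a,b]}f$ be the generalized difference of $f$ across the corners of $(a,b]$. The variation norm $\|f\|_v$ is the supremum of $\sum_J|\Delta_Jf|$ over finite families of disjoint boxes $J=(a,b]\subset(0,1]^s$. The signed measure $df$ generated by $f$ (if it exists it is unique) is the signed measure on $(0,1]^s$ with $df((a,b])=\Delta_{(a,b]}f$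 for all $0\le a\le b\le1$. A function $f$ is cadlag if at every point of the cube it has limits along all quadrants and the limit along the upper right quadrant is the value of $f$. *Derivatives and the class.* Let $Q:[0,1]^d\to\mathbb R$. A family of sequential derivatives of $Q$ up to order $k$ consists of functions $Q^{(j)}_{\bar s(j)}:[0,1]^{s_j}\to\mathbb R$, $0\le j\le k$, with $Q^{(0)}=Q$, such that for $j<k$ and nonempty $s_{j+1}\subset\dots\subset s_1$ the section $Q^{(j)}_{\bar s(j+1)}(x(s_{j+1}))=Q^{(j)}_{\bar s(j)}(x(s_{j+1}),0(s_j\setminus s_{j+1}))$ generates a signed measure on $(0,1]^{s_{j+1}}$ which is absolutely continuous with respect to Lebesgue measure, with integrable density $Q^{(j+1)}_{\bar s(j+1)}=dQ^{(j)}_{\bar s(j+1)}/d\mu$; here $s_0=\{1,\dots,d\}$. The class $D^{(k)}([0,1]^d)$ is the set of $Q$ that have such a family for which moreover, for each $\bar s(k+1)$ with $s_{k+1}\ne\emptyset$, the section $Q^{(k)}_{\bar s(k+1)}$ of $Q^{(k)}_{\bar s(k)}$ is cadlag on $[0,1]^{s_{k+1}}$ with $\|Q^{(k)}_{\bar s(k+1)}\|_v<\infty$.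 For $s_{k+1}=\emptyset$ one lets $Q^{(k)}_{\bar s(k+1)}$ be the constant $Q^{(m)}_{\bar s(m)}(0(s_m))$ (so $Q(0)$ if $s_1=\emptyset$), with variation norm its absolute value. The $k$-th order sectional variation norm is $\|Q\|^*_{v,k}=\sum_{\bar s(k+1)\in\mathcal S^{k+1}(d)}\|Q^{(k)}_{\bar s(k+1)}\|_v$. *Splines and primitives.* $\phi^0_u(x)=I(u\le x)$, $\phi^{j}_u(x)=\int_{(u,x]}\phi^{j-1}_v(x)\,d\mu(v)$; $\bar\phi_{\bar s(n+1)}(x)=\prod_{1\le j\le n,\,s_j\neq\emptyset}\phi^j_0(x(s_j\setminus s_{j+1}))$; $\mu^0(f)=f$, $\mu^j(f)(x)=\int_{(0,x]}\mu^{j-1}(f)\,d\mu$; and, for $s_{k+1}\neq\emptyset$, $\tilde Q^{(k)}_{\bar s(k+1)}(u)=\int_{(0(s_{k+1}),u]}Q^{(k)}_{\bar s(k+1)}(dy)$. *Statement.* Let $Q\in D^{(k)}([0,1]^d)$, and fix any family of derivatives (any choice of versions) as in the definition of the class. Then for every $\bar s(k+1)$ with $s_{k+1}\neq\emptyset$ the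 section $Q^{(k)}_{\bar s(k+1)}$ generates a unique finite signed measure $Q^{(k)}_{\bar s(k+1)}(du)$ on $(0,1]^{s_{k+1}}$, and for every $x\in[0,1]^d$ $$Q(x)=\sum_{\bar s(k+1)\in\mathcal S^{k+1}(d)}\bar\phi_{\bar s(k+1)}(x)\int_{(0(s_{k+1}),x(s_{k+1})]}\phi^k_u(x(s_{k+1}))\,Q^{(k)}_{\bar s(k+1)}(du),$$ the same holds with the integrals taken over all of $(0(s_{k+1}),1(s_{k+1})]$, and $$Q(x)=\sum_{\bar s(k+1)\in\mathcal S^{k+1}(d)}\bar\phi_{\bar s(k+1)}(x)\,\mu^k\big(\tilde Q^{(k)}_{\bar s(k+1)}\big)(x(s_{k+1})),$$ where, by convention, for $s_{k+1}=\emptyset$ both the integral and $\mu^k(\tilde Q^{(k)}_{\bar s(k+1)})$ stand for the constant $Q^{(m)}_{\bar s(m)}(0(s_m))$, $m=m(\bar s(k+1))$. Written out, $$Q(x)=\sum_{\bar s(k+1):\,s_{k+1}=\emptyset}\bar\phi_{\bar s(m+1)}(x)\,Q^{(m)}_{\bar s(m)}(0(s_m))+\sum_{\bar s(k+1):\,s_{k+1}\ne\emptyset}\bar\phi_{\bar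 s(k+1)}(x)\int_{(0,1]^{s_{k+1}}}\phi^k_u(x(s_{k+1}))\,Q^{(k)}_{\bar s(k+1)}(du),$$ and likewise with $\mu^k(\tilde Q^{(k)}_{\bar s(k+1)})(x(s_{k+1}))$ in place of the integral in the second sum. Moreover, the $L_1$-norm of the coefficients equals the $k$-th order sectional variation norm: $$\sum_{\bar s(k+1):\,s_{k+1}=\emptyset}\big|Q^{(m)}_{\bar s(m)}(0(s_m))\big|+\sum_{\bar s(k+1):\,s_{k+1}\ne\emptyset}\int_{(0,1]^{s_{k+1}}}\big|Q^{(k)}_{\bar s(k+1)}(du)\big|=\|Q\|^*_{v,k}.$$ -/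

import Mathlib

open MeasureTheory Filter Topology
open scoped ENNReal

namespace KSpline

noncomputable section

/-! ### Functions on a cube `[0,1]^ι`: boxes, differences, variation, generated measure -/

section Cube

variable {ι : Type*} [Fintype ι]

/-- The half-open box `(a, b] = ∏ᵢ (aᵢ, bᵢ]`. -/
def box (a b : ι → ℝ) : Set (ι → ℝ) := Set.univ.pi fun i => Set.Ioc (a i) (b i)

open Classical in
/-- The generalized difference of `f` across the corners of `(a, b]`:
`∑_T (-1)^|T| f(a on T, b off T)`. -/
def gdiff (f : (ι → ℝ) → ℝ) (a b : ι → ℝ) : ℝ :=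
  ∑ T : Finset ι, (-1) ^ T.card * f fun i => if i ∈ T then a i else b i

/-- `f` is cadlag on `[0,1]^ι`: at each point it has a limit along each of the quadrants (strictly
below in the coordinates of `T`, weakly above in the others) inside the cube, and the limit along
the upper right quadrant is the value of `f`. -/
def IsCadlag (f : (ι → ℝ) → ℝ) : Prop :=
  ∀ x ∈ Set.Icc (0 : ι → ℝ) 1, ∀ T : Set ι, ∃ l : ℝ,
    Tendsto f
      (𝓝[{y | y ∈ Set.Icc (0 : ι → ℝ) 1 ∧ ∀ i, (i ∈ T → y i < x i) ∧ (i ∉ T → x i ≤ y i)}] x)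
      (𝓝 l) ∧ (T = ∅ → l = f x)

/-- The box `(0,1]^ι`, in the form used for partitions into boxes. -/
def unitBox (ι : Type*) : BoxIntegral.Box ι where
  lower := 0
  upper := 1
  lower_lt_upper := fun _ => zero_lt_one

/-- The variation norm `‖f‖_v` of `f` over `(0,1]^ι`: the supremum, over finite families of
disjoint half-open sub-boxes, of the sum of the absolute generalized differences. -/
def varNorm (f : (ι → ℝ) → ℝ) : ℝ≥0∞ :=
  ⨆ π : BoxIntegral.Prepartition (unitBox ι),
    ∑ J ∈ π.boxes, ENNReal.ofReal |gdiff f J.lower J.upper|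

/-- `ν` is the signed measure on `(0,1]^ι` generated by `f`: it gives each box `(a, b]` the
generalized difference of `f`. -/
def IsGeneratedBy (ν : SignedMeasure (ι → ℝ)) (f : (ι → ℝ) → ℝ) : Prop :=
  (∀ a b : ι → ℝ, 0 ≤ a → a ≤ b → b ≤ 1 → ν (box a b) = gdiff f a b) ∧
    ∀ A : Set (ι → ℝ), MeasurableSet A → Disjoint A (box 0 1) → ν A = 0

lemma measurableSet_box (a b : ι → ℝ) : MeasurableSet (box a b) :=
  MeasurableSet.univ_pi fun _ => measurableSet_Ioc

/-- There is at most one signed measure generated by `f`. -/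
theorem IsGeneratedBy.unique {ν ν' : SignedMeasure (ι → ℝ)} {f : (ι → ℝ) → ℝ}
    (h : IsGeneratedBy ν f) (h' : IsGeneratedBy ν' f) : ν = ν' := by
  have key : ∀ {ρ : SignedMeasure (ι → ℝ)}, IsGeneratedBy ρ f → ∀ A, MeasurableSet A →
      ρ A = ρ (A ∩ box 0 1) := by
    intro ρ hρ A hA
    have h1 := VectorMeasure.of_union (v := ρ) (A := A ∩ box 0 1) (B := A \ box 0 1)
      (Set.disjoint_left.2 fun x hx hx' => hx'.2 hx.2)
      (hA.inter (measurableSet_box 0 1)) (hA.diff (measurableSet_box 0 1))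
    rw [Set.inter_union_sdiff, hρ.2 _ (hA.diff (measurableSet_box 0 1))
      Set.disjoint_sdiff_left, add_zero] at h1
    exact h1
  have hgen : (inferInstance : MeasurableSpace (ι → ℝ)) = MeasurableSpace.generateFrom
      (Set.pi Set.univ '' Set.pi Set.univ
        fun _ : ι => {S : Set ℝ | ∃ l u, l ≤ u ∧ Set.Ioc l u = S}) := by
    refine (generateFrom_eq_pi (fun i => ?_) (fun i => ?_)).symm
    · rw [BorelSpace.measurable_eq (α := ℝ), borel_eq_generateFrom_Ioc_le]
    · refine ⟨fun n : ℕ => Set.Ioc (-(n : ℝ)) n, fun n => ⟨_, _, by linarith [n.cast_nonneg (α := ℝ)], rfl⟩, ?_⟩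
      refine Set.eq_univ_of_forall fun x => Set.mem_iUnion.2 ?_
      obtain ⟨n, hn⟩ := exists_nat_gt |x|
      exact ⟨n, (abs_lt.1 hn).1, (abs_lt.1 hn).2.le⟩
  refine VectorMeasure.ext_of_generateFrom _ ?_ hgen (IsPiSystem.pi fun i => ?_) ?_
  · rintro _ ⟨S, hS, rfl⟩
    choose a b hab hS using fun i => hS i (Set.mem_univ i)
    have hSb : Set.pi Set.univ S = box a b := by
      simp only [box]
      congr 1
      ext1 i
      exact (hS i).symm
    rw [hSb, key h _ (measurableSet_box a b), key h' _ (measurableSet_box a b)]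
    have hinter : box a b ∩ box 0 1 = box (a ⊔ 0) (b ⊓ 1) := by
      simp only [box, ← Set.pi_inter_distrib, Set.Ioc_inter_Ioc]
      rfl
    rw [hinter]
    by_cases hle : a ⊔ 0 ≤ b ⊓ 1
    · rw [h.1 _ _ le_sup_right hle inf_le_right, h'.1 _ _ le_sup_right hle inf_le_right]
    · have : box (a ⊔ 0) (b ⊓ 1) = ∅ := by
        rw [Pi.le_def, not_forall] at hle
        obtain ⟨i, hi⟩ := hle
        exact Set.univ_pi_eq_empty (Set.Ioc_eq_empty fun hlt => hi hlt.le)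
      simp [this]
  · rintro _ ⟨a, b, -, rfl⟩ _ ⟨a', b', -, rfl⟩ hne
    rw [Set.Ioc_inter_Ioc] at hne ⊢
    exact ⟨_, _, (Set.nonempty_Ioc.1 hne).le, rfl⟩
  · rw [key h _ MeasurableSet.univ, key h' _ MeasurableSet.univ, Set.univ_inter,
      h.1 0 1 le_rfl zero_le_one le_rfl, h'.1 0 1 le_rfl zero_le_one le_rfl]

open Classical in
/-- The signed measure `df` on `(0,1]^ι` generated by `f` (`0` if there is none). -/
def dMeasure (f : (ι → ℝ) → ℝ) : SignedMeasure (ι → ℝ) :=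
  if h : ∃ ν, IsGeneratedBy ν f then h.choose else 0

/-- `g` is a version of the Radon-Nikodym derivative `df/dμ`: `g` is Lebesgue integrable on
`(0,1]^ι` and the measure generated by `f` is `g dμ`. -/
def IsRNDeriv (f g : (ι → ℝ) → ℝ) : Prop :=
  IntegrableOn g (box 0 1) ∧
    IsGeneratedBy ((volume.restrict (box (0 : ι → ℝ) 1)).withDensityᵥ g) f

open Classical in
/-- The `j`-th order spline `φ_u^j(x)`:
`φ_u^0(x) = I(u ≤ x)` and `φ_u^{j+1}(x) = ∫_{(u,x]} φ_v^j(x) dv`. -/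
def spline : ℕ → (ι → ℝ) → (ι → ℝ) → ℝ
  | 0, u, x => if u ≤ x then 1 else 0
  | j + 1, u, x => ∫ v in box u x, spline j v x

/-- The `j`-th order primitive `μ^j(f)`: `μ^0(f) = f` and `μ^{j+1}(f)(x) = ∫_{(0,x]} μ^j(f) dμ`. -/
def primitive : ℕ → ((ι → ℝ) → ℝ) → (ι → ℝ) → ℝ
  | 0, f, x => f x
  | j + 1, f, x => ∫ y in box 0 x, primitive j f y

end Cube

/-! ### Sections and nested chains of coordinate subsets -/

variable {d : ℕ}

/-- The subvector `x(s)`. -/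
def sub (s : Finset (Fin d)) (x : Fin d → ℝ) : s → ℝ := fun i => x i

/-- The vector `(x(s), 0(-s))`. -/
def zeroExt (s : Finset (Fin d)) (x : s → ℝ) : Fin d → ℝ :=
  fun i => if h : i ∈ s then x ⟨i, h⟩ else 0

/-- The section `x(s) ↦ F(x(s), 0(-s))`, a function on `[0,1]^s`. -/
def sect (s : Finset (Fin d)) (F : (Fin d → ℝ) → ℝ) : (s → ℝ) → ℝ := fun x => F (zeroExt s x)

open Classical in
/-- The set `S^n(d)` of vectors `(s_1, …, s_n)` with `s_n ⊆ … ⊆ s_1 ⊆ {1, …, d}`.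
The entry `s_j` is `s ⟨j - 1, _⟩`. -/
def chains (d n : ℕ) : Finset (Fin n → Finset (Fin d)) :=
  Finset.univ.filter fun s => Antitone s

/-- The initial segment `(s_1, …, s_m)` of `(s_1, …, s_n)` (used for `m ≤ n`). -/
def trunc {n : ℕ} (s : Fin n → Finset (Fin d)) (m : ℕ) : Fin m → Finset (Fin d) :=
  fun i => if h : (i : ℕ) < n then s ⟨i, h⟩ else ∅

/-- `m(s)`: the smallest `m` for which `s_{m+1}` is empty. It is only used when the last entry is
empty; it is `0` exactly when moreover `s_1` is empty. -/
def firstEmpty {n : ℕ} (s : Fin n → Finset (Fin d)) : ℕ :=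
  sInf {m | ∃ h : m < n, s ⟨m, h⟩ = ∅}

/-- The edge factor `φ̄_s(x) = ∏_{j ≤ n, s_j ≠ ∅} φ_0^j(x(s_j \ s_{j+1}))` of
`s = (s_1, …, s_{n+1})`. -/
def phiBar {n : ℕ} (s : Fin (n + 1) → Finset (Fin d)) (x : Fin d → ℝ) : ℝ :=
  ∏ j : Fin n with (s j.castSucc).Nonempty,
    spline (j + 1) 0 (sub (s j.castSucc \ s j.succ) x)

/-! ### Sequentially defined derivatives and the smoothness class -/

/-- A family of functions `Q^{(j)}_{(s_1, …, s_j)}`. The function `Q^{(j)}_{(s_1, …, s_j)}` of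
`x(s_j)` is recorded as a function of `x ∈ ℝ^d`, of which only the values at points
`(x(s_j), 0(-s_j))` matter. -/
abbrev Family (d : ℕ) : Type :=
  (j : ℕ) → (Fin j → Finset (Fin d)) → (Fin d → ℝ) → ℝ

/-- The section `Q^{(k)}_{(s_1, …, s_{k+1})}` of `Q^{(k)}_{(s_1, …, s_k)}`, a function on
`[0,1]^{s_{k+1}}`. -/
def topSect {k : ℕ} (q : Family d) (s : Fin (k + 1) → Finset (Fin d)) :
    (s (Fin.last k) → ℝ) → ℝ :=
  sect (s (Fin.last k)) (q k (trunc s k))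

/-- The constant `Q^{(m)}_{(s_1, …, s_m)}(0(s_m))`, `m = m(s)`, attached to a chain which reaches
the empty set. For `s_1 = ∅` it is `Q(0)`. -/
def constCoef {n : ℕ} (q : Family d) (s : Fin n → Finset (Fin d)) : ℝ :=
  q (firstEmpty s) (trunc s (firstEmpty s)) 0

/-- `q` is a family of (versions of) sequential derivatives up to order `k` which exhibits `Q` as
`k`-th order smooth: `Q^{(0)} = Q`; for nonempty `s_{j+1} ⊆ … ⊆ s_1`, `j < k`, the function
`Q^{(j+1)}_{(s_1, …, s_{j+1})}` is the Radon-Nikodym derivative of the `s_{j+1}`-section of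
`Q^{(j)}_{(s_1, …, s_j)}`; and the sections of the `k`-th order derivatives are cadlag with finite
variation norm. -/
structure IsDerivFamily (k : ℕ) (Q : (Fin d → ℝ) → ℝ) (q : Family d) : Prop where
  zero : ∀ s, ∀ x ∈ Set.Icc (0 : Fin d → ℝ) 1, q 0 s x = Q x
  deriv : ∀ j < k, ∀ s ∈ chains d (j + 1), (s (Fin.last j)).Nonempty →
    IsRNDeriv (sect (s (Fin.last j)) (q j (trunc s j))) (sect (s (Fin.last j)) (q (j + 1) s))
  cadlag : ∀ s ∈ chains d (k + 1), (s (Fin.last k)).Nonempty → IsCadlag (topSect q s)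
  finite : ∀ s ∈ chains d (k + 1), (s (Fin.last k)).Nonempty → varNorm (topSect q s) < ∞

/-- The `k`-th order smoothness class `D^{(k)}([0,1]^d)` (only the values of `Q` on the cube
matter). -/
def smoothClass (d k : ℕ) : Set ((Fin d → ℝ) → ℝ) := {Q | ∃ q, IsDerivFamily k Q q}

open Classical in
/-- The `k`-th order sectional variation norm `∑_s ‖Q^{(k)}_s‖_v`, where the variation norm of a
constant is its absolute value. -/
def sectVarNorm (k : ℕ) (q : Family d) : ℝ≥0∞ :=
  ∑ s ∈ chains d (k + 1),
    if s (Fin.last k) = ∅ then ENNReal.ofReal |constCoef q s| else varNorm (topSect q s)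

/-- `Q̃^{(k)}_s(u) = ∫_{(0,u]} Q^{(k)}_s(dy)`. -/
def tildeQ {k : ℕ} (q : Family d) (s : Fin (k + 1) → Finset (Fin d)) :
    (s (Fin.last k) → ℝ) → ℝ :=
  fun u => dMeasure (topSect q s) (box 0 u)

open Classical in
/-- `μ^k(Q̃^{(k)}_s)` as a function of `x`, with the convention that it is the constant
`Q^{(m)}_{(s_1, …, s_m)}(0(s_m))` if `s_{k+1}` is empty. -/
def primPart {k : ℕ} (q : Family d) (s : Fin (k + 1) → Finset (Fin d)) (x : Fin d → ℝ) : ℝ :=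
  if s (Fin.last k) = ∅ then constCoef q s
  else primitive k (tildeQ q s) (sub (s (Fin.last k)) x)

/-- `∫_B φ_u^k(x(s_{k+1})) Q^{(k)}_s(du)`. -/
def splineInt {k : ℕ} (q : Family d) (s : Fin (k + 1) → Finset (Fin d))
    (B : Set (s (Fin.last k) → ℝ)) (x : Fin d → ℝ) : ℝ :=
  ∫ᵛ u in B, spline k u (sub (s (Fin.last k)) x) ∂•(dMeasure (topSect q s))

open Classical in
/-- `∫_B φ_u^k(x(s_{k+1})) Q^{(k)}_s(du)`, with the convention that it is the constant
`Q^{(m)}_{(s_1, …, s_m)}(0(s_m))` if `s_{k+1}` is empty. -/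
def splinePart {k : ℕ} (q : Family d) (s : Fin (k + 1) → Finset (Fin d))
    (B : Set (s (Fin.last k) → ℝ)) (x : Fin d → ℝ) : ℝ :=
  if s (Fin.last k) = ∅ then constCoef q s else splineInt q s B x

end

end KSpline

open KSpline

open KSpline

/-! A function on a face of the cube is the sum, over the subfaces `t`, of the differences of its
`t`-sections over `(0, x(t)]` (`sect_eq_sum_gdiff`). Applied to `Q`, this is the representation of
order zero. As long as the section has a density, its difference over `(0, u]` is the integral of
the density over that box, and the density is in turn a function on a face `S`, hence again a sum of
differences over the subfaces `t ⊆ S`. Under iterated integration the term of `t` factors: it does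
not depend on the coordinates in `S \ t`, which therefore contribute an iterated primitive of 1,
that is, a spline with knot 0. This is one more factor of `phiBar`, and it carries order `n` to
order `n + 1` (`chainTerm_eq_sum`, iterated in `eq_sum_chainTerm`). A chain that has reached the
empty set carries a constant, which is passed on unchanged.

At order `k` the difference is the mass of `(0, u]` under the generated signed measure. By Fubini
its `k`-fold primitive is the integral of the `k`-th order spline in the knot variable
(`primitive_measureReal`, `vectorIntegral_spline`).

It remains to construct that measure and to compute its norm. The positive and negative parts of the
differences of `f` over the cells of a grid, placed as point masses, have joint mass at most the
variation norm, so they converge weakly along an ultrafilter. Right-continuity identifies the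
differences of the limits on boxes (`exists_measures_gdiff`). The mass bound survives in the limit
and gives one inequality between total variation and variation norm; the other follows by testing on
disjoint boxes (`totalVariation_dMeasure`). -/

namespace KSpline

/-! ### Finite linear combinations of point values -/

section PointCombinations

variable {ι : Type*}

/-- `L f` is a linear combination of finitely many values of `f`. -/
def IsPointComb (L : ((ι → ℝ) → ℝ) → ℝ) : Prop :=
  ∃ c : (ι → ℝ) →₀ ℝ, ∀ f, L f = c.sum fun p r => r * f p

lemma isPointComb_eval (x : ι → ℝ) : IsPointComb fun f => f x :=
  ⟨Finsupp.single x 1, fun f => by simp⟩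

lemma IsPointComb.const_mul {L : ((ι → ℝ) → ℝ) → ℝ} (h : IsPointComb L) (r : ℝ) :
    IsPointComb fun f => r * L f := by
  obtain ⟨c, hc⟩ := h
  refine ⟨r • c, fun f => ?_⟩
  change r * L f = _
  rw [Finsupp.sum_smul_index (by simp), hc, Finsupp.mul_sum]
  simp [mul_assoc]

lemma IsPointComb.sum {κ : Type*} (s : Finset κ) {L : κ → ((ι → ℝ) → ℝ) → ℝ}
    (h : ∀ k ∈ s, IsPointComb (L k)) : IsPointComb fun f => ∑ k ∈ s, L k f := by
  classical
  choose! c hc using h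
  refine ⟨∑ k ∈ s, c k, fun f => ?_⟩
  rw [← Finsupp.sum_finsetSum_index (by simp) (by intros; ring)]
  exact Finset.sum_congr rfl fun k hk => hc k hk f

end PointCombinations

/-! ### Algebra of generalized differences, reduced to product functions -/

section Differences

variable {ι : Type*} [Fintype ι]

open Classical in
/-- The corner of `(a, b]` which takes the coordinates in `T` from `a` and the others from `b`. -/
noncomputable def corner (a b : ι → ℝ) (T : Finset ι) : ι → ℝ := fun i => if i ∈ T then a i else b i

lemma gdiff_eq_sum_corner (f : (ι → ℝ) → ℝ) (a b : ι → ℝ) :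
    gdiff f a b = ∑ T : Finset ι, (-1) ^ T.card * f (corner a b T) := rfl

lemma gdiff_congr {f g : (ι → ℝ) → ℝ} {a b : ι → ℝ}
    (h : ∀ x, (∀ i, x i = a i ∨ x i = b i) → f x = g x) : gdiff f a b = gdiff g a b := by
  classical
  simp only [gdiff_eq_sum_corner]
  refine Finset.sum_congr rfl fun T _ => ?_
  rw [h]
  intro i
  by_cases hi : i ∈ T <;> simp [corner, hi]

/-- Expanding the product on the right, a subset `T` records the factors from which the value at `a`
is taken; this is the corner sum. -/
lemma gdiff_prod (g : ι → ℝ → ℝ) (a b : ι → ℝ) :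
    gdiff (fun x => ∏ i, g i (x i)) a b = ∏ i, (g i (b i) - g i (a i)) := by
  classical
  rw [gdiff_eq_sum_corner, Finset.prod_sub, Finset.powerset_univ]
  refine Finset.sum_congr rfl fun T _ => ?_
  rw [← Finset.prod_sdiff (Finset.subset_univ T), mul_assoc]
  congr 2
  · refine Finset.prod_congr rfl fun i hi => ?_
    simp [corner, (Finset.mem_sdiff.1 hi).2]
  · refine Finset.prod_congr rfl fun i hi => ?_
    simp [corner, hi]

lemma gdiff_const_mul (c : ℝ) (f : (ι → ℝ) → ℝ) (a b : ι → ℝ) :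
    gdiff (fun x => c * f x) a b = c * gdiff f a b := by
  simp only [gdiff_eq_sum_corner, Finset.mul_sum]
  exact Finset.sum_congr rfl fun T _ => by ring

lemma isPointComb_gdiff (a b : ι → ℝ) : IsPointComb fun f => gdiff f a b :=
  IsPointComb.sum _ fun T _ => (isPointComb_eval (corner a b T)).const_mul _

/-- Two finite combinations of point values which agree on product functions are equal. -/
lemma IsPointComb.eq_of_prod {L L' : ((ι → ℝ) → ℝ) → ℝ} (h : IsPointComb L) (h' : IsPointComb L')
    (hprod : ∀ g : ι → ℝ → ℝ, (L fun x => ∏ i, g i (x i)) = L' fun x => ∏ i, g i (x i))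
    (f : (ι → ℝ) → ℝ) : L f = L' f := by
  classical
  obtain ⟨c, hc⟩ := h
  obtain ⟨c', hc'⟩ := h'
  let S := c.support ∪ c'.support
  -- The indicator of a single point is a product function, and on the finite set `S` every `f` is a
  -- linear combination of such indicators.
  let D : (ι → ℝ) → (ι → ℝ) → ℝ := fun p x => ∏ i, if x i = p i then 1 else 0
  have hD : ∀ p x, D p x = if x = p then 1 else 0 := fun p x => by
    simp only [D, Finset.prod_ite_zero, Finset.prod_const_one, Finset.mem_univ, true_imp_iff,
      funext_iff]
  have hf : ∀ x ∈ S, f x = ∑ p ∈ S, f p * D p x := fun x hx => by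
    simp [hD, hx]
  have e : ∀ (c : (ι → ℝ) →₀ ℝ), c.support ⊆ S →
      (c.sum fun p r => r * f p) = ∑ p ∈ S, f p * c.sum fun q r => r * D p q := by
    intro c hcS
    simp only [Finsupp.sum, Finset.mul_sum]
    rw [Finset.sum_comm]
    refine Finset.sum_congr rfl fun x hx => ?_
    rw [hf x (hcS hx), Finset.mul_sum]
    exact Finset.sum_congr rfl fun p _ => by ring
  rw [hc, hc', e c Finset.subset_union_left, e c' Finset.subset_union_right]
  refine Finset.sum_congr rfl fun p _ => ?_
  rw [← hc, ← hc', hprod fun i t => if t = p i then 1 else 0]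

/-- On a product, the inner difference only subtracts the constant `g i (o i)` from each factor,
which the outer difference does not see. -/
lemma gdiff_gdiff (f : (ι → ℝ) → ℝ) (o a b : ι → ℝ) :
    gdiff (fun c => gdiff f o c) a b = gdiff f a b := by
  refine IsPointComb.eq_of_prod (L := fun f => gdiff (fun c => gdiff f o c) a b)
    (L' := fun f => gdiff f a b) ?_ (isPointComb_gdiff a b) (fun g => ?_) f
  · exact IsPointComb.sum _ fun T _ => (isPointComb_gdiff o (corner a b T)).const_mul _
  · simp only [gdiff_prod]
    rw [gdiff_prod fun i t => g i t - g i (o i)]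
    simp

/-- The generalized differences over the cells of a grid add up. -/
lemma sum_gdiff_grid [DecidableEq ι] (f : (ι → ℝ) → ℝ) (u : ℕ → ℝ) (m : ι → ℕ) :
    ∑ k ∈ Fintype.piFinset fun i => Finset.range (m i),
      gdiff f (fun i => u (k i)) (fun i => u (k i + 1)) =
      gdiff f (fun _ => u 0) (fun i => u (m i)) := by
  refine IsPointComb.eq_of_prod (L := fun f => ∑ k ∈ Fintype.piFinset fun i => Finset.range (m i),
      gdiff f (fun i => u (k i)) (fun i => u (k i + 1)))
    (L' := fun f => gdiff f (fun _ => u 0) (fun i => u (m i)))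
    (IsPointComb.sum _ fun k _ => isPointComb_gdiff _ _) (isPointComb_gdiff _ _) (fun g => ?_) f
  simp only [gdiff_prod]
  rw [← Finset.prod_univ_sum (fun i => Finset.range (m i))
    (fun i j => g i (u (j + 1)) - g i (u j))]
  exact Finset.prod_congr rfl fun i _ => Finset.sum_range_sub (fun j => g i (u j)) (m i)

end Differences

/-- A function on a face of the cube is the sum of its generalized differences over the subfaces. -/
lemma sect_eq_sum_gdiff {d : ℕ} (F : (Fin d → ℝ) → ℝ) (s : Finset (Fin d)) (y : s → ℝ) :
    sect s F y = ∑ t ∈ s.powerset, gdiff (sect t F) 0 (sub t (zeroExt s y)) := by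
  refine IsPointComb.eq_of_prod (L := fun F => sect s F y)
    (L' := fun F => ∑ t ∈ s.powerset, gdiff (sect t F) 0 (sub t (zeroExt s y)))
    (isPointComb_eval (zeroExt s y)) ?_ (fun g => ?_) F
  · refine IsPointComb.sum _ fun t _ => ?_
    exact IsPointComb.sum _ fun T _ => (isPointComb_eval (zeroExt t (corner _ _ T))).const_mul _
  · have h1 : ∀ t : Finset (Fin d), sect t (fun x => ∏ i, g i (x i)) =
        fun w : t → ℝ => (∏ i ∈ tᶜ, g i 0) * ∏ i : t, g i (w i) := by
      intro t
      funext w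
      rw [sect, ← Finset.prod_compl_mul_prod t, ← Finset.prod_coe_sort t]
      congr 1
      · refine Finset.prod_congr rfl fun i hi => ?_
        rw [zeroExt, dif_neg (Finset.mem_compl.1 hi)]
      · refine Finset.prod_congr rfl fun i _ => ?_
        rw [zeroExt, dif_pos i.2]
    simp only [h1, gdiff_const_mul]
    set z := zeroExt s y with hz
    -- For products the identity is the expansion of a product of sums: `t` is the set of factors
    -- from which the increment is chosen.
    have h2 : ∏ i : s, g i (y i) = ∏ i ∈ s, ((g i (z i) - g i 0) + g i 0) := by
      rw [← Finset.prod_coe_sort s]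
      refine Finset.prod_congr rfl fun i _ => ?_
      simp [hz, zeroExt]
    rw [h2, Finset.prod_add, Finset.mul_sum]
    refine Finset.sum_congr rfl fun t ht => ?_
    rw [gdiff_prod fun (i : t) r => g i r]
    have h3 : ∏ i : t, (g i (sub t z i) - g i ((0 : t → ℝ) i)) = ∏ i ∈ t, (g i (z i) - g i 0) := by
      rw [← Finset.prod_coe_sort t]; rfl
    have h4 : ∏ i ∈ tᶜ, g i 0 = (∏ i ∈ sᶜ, g i 0) * ∏ i ∈ s \ t, g i 0 := by
      rw [← Finset.prod_union]
      · refine Finset.prod_congr ?_ fun _ _ => rfl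
        have := Finset.mem_powerset.1 ht
        ext i
        have := @this i
        simp only [Finset.mem_compl, Finset.mem_union, Finset.mem_sdiff]
        tauto
      · exact Finset.disjoint_left.2 fun i hi hi' =>
          Finset.mem_compl.1 hi (Finset.mem_sdiff.1 hi').1
    rw [h3, h4]
    ring

/-! ### Weak convergence on sets with null boundary -/

section Portmanteau

/-- The upper bound for closed sets is applied to the closure of `E` and to the complement of its
interior. Since the masses vary, the second use also needs the convergence of total masses. -/
lemma tendsto_real_of_null_frontier {Ω κ : Type*} [MeasurableSpace Ω] [TopologicalSpace Ω]
    [OpensMeasurableSpace Ω] [HasOuterApproxClosed Ω] {L : Filter κ} {μs : κ → FiniteMeasure Ω}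
    {μ : FiniteMeasure Ω} (h : Tendsto μs L (𝓝 μ)) {E : Set Ω}
    (hE : (μ : Measure Ω) (frontier E) = 0) :
    Tendsto (fun i => (μs i : Measure Ω).real E) L (𝓝 ((μ : Measure Ω).real E)) := by
  have hclosed : ∀ F : Set Ω, IsClosed F → ∀ r, (μ : Measure Ω).real F < r →
      ∀ᶠ i in L, (μs i : Measure Ω).real F < r := by
    intro F hF r hr
    have h1 := FiniteMeasure.limsup_measure_closed_le_of_tendsto h hF
    have h2 : (μ : Measure Ω) F < ENNReal.ofReal r :=
      (ENNReal.lt_ofReal_iff_toReal_lt (measure_ne_top _ _)).2 hr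
    filter_upwards [eventually_lt_of_limsup_lt (h1.trans_lt h2)] with i hi
    exact (ENNReal.lt_ofReal_iff_toReal_lt (measure_ne_top _ _)).1 hi
  have hmass : Tendsto (fun i => (μs i : Measure Ω).real Set.univ) L
      (𝓝 ((μ : Measure Ω).real Set.univ)) :=
    (NNReal.tendsto_coe.2 ((FiniteMeasure.continuous_mass.tendsto μ).comp h) :)
  have hint : (μ : Measure Ω).real (interior E) = (μ : Measure Ω).real E := by
    simp only [Measure.real, measure_interior_of_null_frontier hE]
  have hclo : (μ : Measure Ω).real (closure E) = (μ : Measure Ω).real E := by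
    simp only [Measure.real, measure_closure_of_null_frontier hE]
  refine tendsto_order.2 ⟨fun r hr => ?_, fun r hr => ?_⟩
  · set δ := (μ : Measure Ω).real E - r
    have hδ : 0 < δ := sub_pos.2 hr
    have hc : ∀ ν : Measure Ω, [IsFiniteMeasure ν] →
        ν.real (interior E)ᶜ = ν.real Set.univ - ν.real (interior E) := fun ν _ =>
      measureReal_compl isOpen_interior.measurableSet
    have h1 := hclosed (interior E)ᶜ isOpen_interior.isClosed_compl
      ((μ : Measure Ω).real (interior E)ᶜ + δ / 2) (by linarith)
    have h2 := (tendsto_order.1 hmass).1 ((μ : Measure Ω).real Set.univ - δ / 2) (by linarith)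
    filter_upwards [h1, h2] with i hi1 hi2
    rw [hc, hc] at hi1
    have : (μs i : Measure Ω).real (interior E) ≤ (μs i : Measure Ω).real E :=
      measureReal_mono interior_subset
    simp only [δ] at *
    linarith
  · filter_upwards [hclosed _ isClosed_closure r (hclo.trans_lt hr)] with i hi
    exact (measureReal_mono subset_closure).trans_lt hi

end Portmanteau

/-! ### Measures of boxes and distribution functions -/

section Boxes

lemma box_mono {ι : Type*} {a a' b b' : ι → ℝ} (ha : a' ≤ a) (hb : b ≤ b') : box a b ⊆ box a' b' :=
  Set.pi_mono fun i _ => Set.Ioc_subset_Ioc (ha i) (hb i)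

variable {ι : Type*} [Fintype ι]

lemma prod_indicator_le (y c : ι → ℝ) :
    ∏ i, (if y i ≤ c i then (1 : ℝ) else 0) = (Set.Iic c).indicator (fun _ => 1) y := by
  classical
  rw [Finset.prod_ite_zero]
  simp [Set.indicator_apply, Pi.le_def]

/-- As a function of `c` the indicator is a product of half-line indicators, and each factor has the
indicator of `(a i, b i]` as its increment. -/
lemma gdiff_indicator_Iic {a b : ι → ℝ} (hab : a ≤ b) (y : ι → ℝ) :
    gdiff (fun c => (Set.Iic c).indicator (fun _ => (1 : ℝ)) y) a b =
      (box a b).indicator (fun _ => 1) y := by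
  classical
  simp only [← prod_indicator_le]
  rw [gdiff_prod fun i t => if y i ≤ t then (1 : ℝ) else 0]
  have : ∀ i, ((if y i ≤ b i then (1 : ℝ) else 0) - if y i ≤ a i then 1 else 0) =
      if y i ∈ Set.Ioc (a i) (b i) then 1 else 0 := by
    intro i
    have := hab i
    simp only [Set.mem_Ioc]
    split_ifs <;> grind
  simp only [this]
  rw [Finset.prod_ite_zero]
  simp [Set.indicator_apply, box]

lemma integral_gdiff {Ω : Type*} [MeasurableSpace Ω] (P : Measure Ω) (h : (ι → ℝ) → Ω → ℝ)
    (hint : ∀ c, Integrable (h c) P) (a b : ι → ℝ) :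
    ∫ y, gdiff (fun c => h c y) a b ∂P = gdiff (fun c => ∫ y, h c y ∂P) a b := by
  simp only [gdiff_eq_sum_corner]
  rw [integral_finsetSum _ fun T _ => (hint _).const_mul _]
  simp only [integral_const_mul]

lemma measureReal_box (P : Measure (ι → ℝ)) [IsFiniteMeasure P] {a b : ι → ℝ} (hab : a ≤ b) :
    P.real (box a b) = gdiff (fun c => P.real (Set.Iic c)) a b := by
  have h := integral_gdiff P (fun c y => (Set.Iic c).indicator (fun _ => (1 : ℝ)) y)
    (fun c => (integrable_const _).indicator measurableSet_Iic) a b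
  simp only [gdiff_indicator_Iic hab] at h
  rw [integral_indicator_const _ (measurableSet_box a b)] at h
  simp only [integral_indicator_const _ measurableSet_Iic] at h
  simpa using h

lemma frontier_Iic_subset (c : ι → ℝ) : frontier (Set.Iic c) ⊆ ⋃ i, {y | y i = c i} := by
  intro y hy
  rw [frontier, isClosed_Iic.closure_eq] at hy
  by_contra hne
  simp only [Set.mem_iUnion, Set.mem_ofPred_eq, not_exists] at hne
  refine hy.2 (mem_interior.2 ⟨Set.univ.pi fun i => Set.Iio (c i), fun z hz i => ?_, ?_, ?_⟩)
  · exact (hz i trivial).le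
  · exact isOpen_set_pi Set.finite_univ fun i _ => isOpen_Iio
  · exact fun i _ => lt_of_le_of_ne (hy.1 i) (hne i)

lemma tendsto_measureReal_Iic (P : Measure (ι → ℝ)) [IsFiniteMeasure P] {b : ι → ℝ}
    {c : ℕ → ι → ℝ} (hbc : ∀ n, b ≤ c n) (hc : Tendsto c atTop (𝓝 b)) :
    Tendsto (fun n => P.real (Set.Iic (c n))) atTop (𝓝 (P.real (Set.Iic b))) := by
  have h : ∀ c : ι → ℝ, P.real (Set.Iic c) = ∫ y, (Set.Iic c).indicator (fun _ => (1 : ℝ)) y ∂P :=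
    fun c => by rw [integral_indicator_const _ measurableSet_Iic]; simp
  simp_rw [h]
  refine tendsto_integral_of_dominated_convergence (fun _ => 1)
    (fun n => (measurable_const.indicator measurableSet_Iic).aestronglyMeasurable)
    (integrable_const _) (fun n => ae_of_all _ fun y => ?_) (ae_of_all _ fun y => ?_)
  · exact (norm_indicator_le_norm_self _ _).trans (by simp)
  · refine tendsto_const_nhds.congr' ?_
    by_cases hy : y ≤ b
    · exact Eventually.of_forall fun n => by simp [hy, hy.trans (hbc n)]
    · obtain ⟨i, hi⟩ := not_forall.1 hy
      have := (tendsto_pi_nhds.1 hc i).eventually_lt_const (not_le.1 hi)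
      filter_upwards [this] with n hn
      have h' : ¬ y ≤ c n := fun h => (h i).not_gt hn
      simp [hy, h']

/-- Points with a null upper boundary accumulate at every point from above. -/
lemma exists_seq_null_faces (P : Measure (ι → ℝ)) [IsFiniteMeasure P] (b : ι → ℝ) :
    ∃ c : ℕ → ι → ℝ, (∀ n, b ≤ c n) ∧ Tendsto c atTop (𝓝 b) ∧
      ∀ n, P (frontier (Set.Iic (c n))) = 0 := by
  have h1 : ∀ (i : ι) (n : ℕ), ∃ t, b i < t ∧ t < b i + 1 / ((n : ℝ) + 1) ∧
      P {y | y i = t} = 0 := by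
    intro i n
    -- The hyperplanes `y i = t` are disjoint, so a finite measure charges only countably many of
    -- them and `t` can be chosen off this set.
    have hcount : {t : ℝ | 0 < P {y | y i = t}}.Countable :=
      Measure.countable_meas_level_set_pos (measurable_pi_apply i)
    have hpos : b i < b i + 1 / ((n : ℝ) + 1) := by
      have : (0 : ℝ) < 1 / ((n : ℝ) + 1) := by positivity
      linarith
    obtain ⟨t, ht, h1, h2⟩ := (hcount.dense_compl ℝ).exists_between hpos
    exact ⟨t, h1, h2, by simpa using ht⟩
  choose t ht1 ht2 ht3 using h1
  refine ⟨fun n i => t i n, fun n i => (ht1 i n).le, ?_, fun n => ?_⟩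
  · refine tendsto_pi_nhds.2 fun i => ?_
    refine tendsto_of_tendsto_of_tendsto_of_le_of_le tendsto_const_nhds
      (h := fun n : ℕ => b i + 1 / ((n : ℝ) + 1)) ?_ (fun n => (ht1 i n).le) fun n => (ht2 i n).le
    simpa using tendsto_const_nhds.add (tendsto_one_div_add_atTop_nhds_zero_nat (𝕜 := ℝ))
  · exact measure_mono_null (frontier_Iic_subset _) (measure_iUnion_null fun i => ht3 i n)

end Boxes

/-! ### Right-continuity of differences of cadlag functions -/

section RightContinuity

variable {ι : Type*}

/-- Only the quadrant `T = ∅` of the cadlag property enters the proof. -/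
lemma IsCadlag.tendsto_right {f : (ι → ℝ) → ℝ} (hf : IsCadlag f) {x : ι → ℝ}
    (hx : x ∈ Set.Icc (0 : ι → ℝ) 1) : Tendsto f (𝓝[Set.Icc x 1] x) (𝓝 (f x)) := by
  obtain ⟨l, hl, hl'⟩ := hf x hx ∅
  rw [hl' rfl] at hl
  refine hl.mono_left (nhdsWithin_mono _ fun y hy => ?_)
  exact ⟨⟨hx.1.trans hy.1, hy.2⟩, fun i => ⟨fun h => h.elim, fun _ => hy.1 i⟩⟩

lemma IsCadlag.tendsto_gdiff [Fintype ι] {f : (ι → ℝ) → ℝ} (hf : IsCadlag f) {κ : Type*} {L : Filter κ}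
    {x : ι → ℝ} (hx : x ∈ Set.Icc (0 : ι → ℝ) 1) {c : κ → ι → ℝ} (hxc : ∀ n, x ≤ c n)
    (hc1 : ∀ n, c n ≤ 1) (hc : Tendsto c L (𝓝 x)) :
    Tendsto (fun n => gdiff f 0 (c n)) L (𝓝 (gdiff f 0 x)) := by
  simp only [gdiff_eq_sum_corner]
  refine tendsto_finsetSum _ fun T _ => Tendsto.const_mul _ ?_
  have hmem : corner 0 x T ∈ Set.Icc (0 : ι → ℝ) 1 := by
    constructor <;> intro i <;> by_cases hi : i ∈ T <;> simp [corner, hi]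
    · exact hx.1 i
    · exact hx.2 i
  refine (hf.tendsto_right hmem).comp (tendsto_nhdsWithin_iff.2 ⟨?_, ?_⟩)
  · refine tendsto_pi_nhds.2 fun i => ?_
    by_cases hi : i ∈ T
    · simpa [corner, hi] using tendsto_const_nhds
    · simpa [corner, hi] using tendsto_pi_nhds.1 hc i
  · refine Eventually.of_forall fun n => ⟨fun i => ?_, fun i => ?_⟩
    · by_cases hi : i ∈ T
      · simp [corner, hi]
      · simpa [corner, hi] using hxc n i
    · by_cases hi : i ∈ T
      · simp [corner, hi]
      · simpa [corner, hi] using hc1 n i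

end RightContinuity

/-! ### Discrete approximations of the generated measure on grids -/

section Grid

variable {ι : Type*}

/-- The indices of the cells `∏ᵢ (kᵢ / N, (kᵢ + 1) / N]` of a grid on the unit cube. -/
def gridIndex (ι : Type*) [Fintype ι] [DecidableEq ι] (N : ℕ) : Finset (ι → ℕ) :=
  Fintype.piFinset fun _ => Finset.range N

/-- The grid point with index `k`. -/
noncomputable def gridPoint (N : ℕ) (k : ι → ℕ) : ι → ℝ := fun i => (k i : ℝ) / N

/-- The generalized difference of `f` over the grid cell with index `k`. -/
noncomputable def gridWeight [Fintype ι] (f : (ι → ℝ) → ℝ) (N : ℕ) (k : ι → ℕ) : ℝ :=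
  gdiff f (gridPoint N k) (gridPoint N (k + 1))

/-- The measure which puts the positive part of the difference of `f` over each grid cell on the
lower corner of the cell. -/
noncomputable def gridMeasure [Fintype ι] [DecidableEq ι] (f : (ι → ℝ) → ℝ) (N : ℕ) : Measure (ι → ℝ) :=
  ∑ k ∈ gridIndex ι N, ENNReal.ofReal (gridWeight f N k) • Measure.dirac (gridPoint N k)

lemma gridWeight_neg [Fintype ι] (f : (ι → ℝ) → ℝ) (N : ℕ) (k : ι → ℕ) :
    gridWeight (fun x => -f x) N k = -gridWeight f N k := by
  simpa [gridWeight] using gdiff_const_mul (-1) f (gridPoint N k) (gridPoint N (k + 1))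

lemma gridMeasure_apply [Fintype ι] [DecidableEq ι] (f : (ι → ℝ) → ℝ) (N : ℕ) {A : Set (ι → ℝ)} (hA : MeasurableSet A) :
    gridMeasure f N A =
      ∑ k ∈ gridIndex ι N, ENNReal.ofReal (gridWeight f N k) * A.indicator 1 (gridPoint N k) := by
  simp [gridMeasure, Measure.finsetSum_apply, Measure.dirac_apply' _ hA]

instance isFiniteMeasure_gridMeasure [Fintype ι] [DecidableEq ι] (f : (ι → ℝ) → ℝ) (N : ℕ) : IsFiniteMeasure (gridMeasure f N) := by
  refine ⟨?_⟩
  rw [gridMeasure_apply _ _ MeasurableSet.univ]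
  simp [ENNReal.sum_lt_top]

/-- `gridMeasure` as a finite measure. -/
noncomputable def gridFiniteMeasure [Fintype ι] [DecidableEq ι] (f : (ι → ℝ) → ℝ) (N : ℕ) : FiniteMeasure (ι → ℝ) :=
  ⟨gridMeasure f N, inferInstance⟩

lemma coe_gridFiniteMeasure [Fintype ι] [DecidableEq ι] (f : (ι → ℝ) → ℝ) (N : ℕ) :
    (gridFiniteMeasure f N : Measure (ι → ℝ)) = gridMeasure f N := rfl

lemma gridPoint_mem_Icc [Fintype ι] [DecidableEq ι] {N : ℕ} {k : ι → ℕ} (hk : k ∈ gridIndex ι N) :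
    gridPoint N k ∈ Set.Icc (0 : ι → ℝ) 1 := by
  refine ⟨fun i => by simp only [gridPoint, Pi.zero_apply]; positivity, fun i => ?_⟩
  have := Finset.mem_range.1 (Fintype.mem_piFinset.1 hk i)
  exact div_le_one_of_le₀ (Nat.cast_le.2 this.le) (Nat.cast_nonneg _)

lemma gridMeasure_compl_Icc [Fintype ι] [DecidableEq ι] (f : (ι → ℝ) → ℝ) (N : ℕ) :
    gridMeasure f N (Set.Icc (0 : ι → ℝ) 1)ᶜ = 0 := by
  rw [gridMeasure_apply _ _ measurableSet_Icc.compl]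
  refine Finset.sum_eq_zero fun k hk => ?_
  rw [Set.indicator_of_notMem (Set.notMem_compl_iff.2 (gridPoint_mem_Icc hk)), mul_zero]

/-- The cell of the grid with index `k`, as a box. -/
noncomputable def gridBox (N : ℕ) (hN : 0 < N) (k : ι → ℕ) : BoxIntegral.Box ι where
  lower := gridPoint N k
  upper := gridPoint N (k + 1)
  lower_lt_upper := fun i => by
    have : (0 : ℝ) < N := by exact_mod_cast hN
    simp only [gridPoint, Pi.add_apply, Pi.one_apply]
    gcongr
    simp

lemma gridBox_injective (N : ℕ) (hN : 0 < N) :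
    Function.Injective (gridBox N hN : (ι → ℕ) → BoxIntegral.Box ι) := by
  intro k l h
  have h1 : gridPoint N k = gridPoint N l := congrArg BoxIntegral.Box.lower h
  have hN' : (N : ℝ) ≠ 0 := by exact_mod_cast hN.ne'
  funext i
  have := congrFun h1 i
  simp only [gridPoint] at this
  field_simp at this
  exact_mod_cast this

/-- The partition of the unit cube into the cells of the grid. -/
noncomputable def gridPartition [Fintype ι] [DecidableEq ι] (N : ℕ) (hN : 0 < N) :
    BoxIntegral.Prepartition (unitBox ι) where
  boxes := (gridIndex ι N).map ⟨gridBox N hN, gridBox_injective N hN⟩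
  le_of_mem' J hJ := by
    obtain ⟨k, hk, rfl⟩ := Finset.mem_map.1 hJ
    refine BoxIntegral.Box.le_iff_bounds.2 ⟨(gridPoint_mem_Icc hk).1, fun i => ?_⟩
    have := Finset.mem_range.1 (Fintype.mem_piFinset.1 hk i)
    exact div_le_one_of_le₀ (Nat.cast_le.2 this) (Nat.cast_nonneg _)
  pairwiseDisjoint := by
    intro I hI J hJ hne
    obtain ⟨k, -, rfl⟩ := Finset.mem_map.1 hI
    obtain ⟨l, -, rfl⟩ := Finset.mem_map.1 hJ
    refine Set.disjoint_left.2 fun x hx hx' => hne ?_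
    have hN' : (0 : ℝ) < N := by exact_mod_cast hN
    congr 1
    funext i
    have h1 := hx i
    have h2 := hx' i
    simp only [Function.Embedding.coeFn_mk, gridBox, gridPoint, Set.mem_Ioc, Pi.add_apply,
      Pi.one_apply, div_lt_iff₀ hN', le_div_iff₀ hN'] at h1 h2
    have h3 : k i < l i + 1 := by exact_mod_cast h1.1.trans_le h2.2
    have h4 : l i < k i + 1 := by exact_mod_cast h2.1.trans_le h1.2
    omega

lemma sum_abs_gridWeight_le [Fintype ι] [DecidableEq ι] (f : (ι → ℝ) → ℝ) {N : ℕ} (hN : 0 < N) :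
    ∑ k ∈ gridIndex ι N, ENNReal.ofReal |gridWeight f N k| ≤ varNorm f := by
  refine le_trans (le_of_eq ?_) (le_iSup _ (gridPartition N hN))
  simp only [gridPartition, Finset.sum_map]
  rfl

/-- The positive and negative parts of each cell difference add up to its absolute value. Bounding
the two masses jointly, rather than each separately, is what yields the sharp norm later. -/
lemma gridMeasure_univ_add [Fintype ι] [DecidableEq ι] (f : (ι → ℝ) → ℝ) {N : ℕ} (hN : 0 < N) :
    gridMeasure f N Set.univ + gridMeasure (fun x => -f x) N Set.univ ≤ varNorm f := by
  refine le_trans (le_of_eq ?_) (sum_abs_gridWeight_le f hN)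
  rw [gridMeasure_apply _ _ MeasurableSet.univ, gridMeasure_apply _ _ MeasurableSet.univ,
    ← Finset.sum_add_distrib]
  refine Finset.sum_congr rfl fun k _ => ?_
  rw [gridWeight_neg]
  rcases le_total 0 (gridWeight f N k) with h | h
  · simp [h, abs_of_nonneg]
  · simp [h, abs_of_nonpos]

/-- The least grid point above `c` within the unit cube. -/
noncomputable def gridAbove (N : ℕ) (c : ι → ℝ) : ι → ℝ :=
  gridPoint N fun i => min N (⌊(N : ℝ) * c i⌋₊ + 1)

/-- Positive part minus negative part is the signed cell difference. The cells whose lower corner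
lies below `c` tile the box from 0 to `gridAbove N c`, so these differences telescope. -/
lemma gridMeasure_Iic_sub [Fintype ι] [DecidableEq ι] (f : (ι → ℝ) → ℝ) {N : ℕ} (hN : 0 < N) {c : ι → ℝ} (hc : 0 ≤ c) :
    (gridMeasure f N).real (Set.Iic c) - (gridMeasure (fun x => -f x) N).real (Set.Iic c) =
      gdiff f 0 (gridAbove N c) := by
  classical
  have hN' : (0 : ℝ) < N := by exact_mod_cast hN
  have h1 : ∀ f : (ι → ℝ) → ℝ, (gridMeasure f N).real (Set.Iic c) = ∑ k ∈ gridIndex ι N,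
      max (gridWeight f N k) 0 * (Set.Iic c).indicator 1 (gridPoint N k) := by
    intro f
    rw [Measure.real, gridMeasure_apply _ _ measurableSet_Iic, ENNReal.toReal_sum]
    · refine Finset.sum_congr rfl fun k _ => ?_
      rw [ENNReal.toReal_mul, ENNReal.toReal_ofReal']
      congr 1
      simp only [Set.indicator_apply]
      split_ifs <;> simp
    · intro k _
      refine ENNReal.mul_ne_top (by simp) ?_
      simp only [Set.indicator_apply]
      split_ifs <;> simp
  have h2 : (gridIndex ι N).filter (fun k => gridPoint N k ∈ Set.Iic c) =
      Fintype.piFinset fun i => Finset.range (min N (⌊(N : ℝ) * c i⌋₊ + 1)) := by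
    ext k
    simp only [gridIndex, Finset.mem_filter, Fintype.mem_piFinset, Finset.mem_range, Set.mem_Iic,
      Pi.le_def, ← forall_and, gridPoint]
    refine forall_congr' fun i => ?_
    rw [lt_min_iff, Nat.lt_succ_iff, Nat.le_floor_iff (mul_nonneg hN'.le (hc i)),
      div_le_iff₀ hN', mul_comm (c i)]
  have h3 := sum_gdiff_grid f (fun j => (j : ℝ) / N) fun i => min N (⌊(N : ℝ) * c i⌋₊ + 1)
  rw [← h2, Finset.sum_filter] at h3
  have h4 : gdiff f 0 (gridAbove N c) = gdiff f (fun _ => ((0 : ℕ) : ℝ) / N)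
      (fun i => ((min N (⌊(N : ℝ) * c i⌋₊ + 1) : ℕ) : ℝ) / N) := by
    congr 1
    funext i
    simp
  rw [h4, ← h3, h1, h1, ← Finset.sum_sub_distrib]
  refine Finset.sum_congr rfl fun k _ => ?_
  rw [gridWeight_neg, ← sub_mul]
  have h5 : max (gridWeight f N k) 0 - max (-gridWeight f N k) 0 = gridWeight f N k := by
    rcases le_total 0 (gridWeight f N k) with h | h
    · rw [max_eq_left h, max_eq_right (by linarith)]; ring
    · rw [max_eq_right h, max_eq_left (by linarith)]; ring
  rw [h5, Set.indicator_apply]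
  split_ifs
  · rw [Pi.one_apply, mul_one]
    rfl
  · simp

/-- With the atoms on lower corners, the grid points approach `c ⊓ 1` from above, the side on which
`f` is continuous. -/
lemma gridAbove_bounds {N : ℕ} (hN : 0 < N) {c : ι → ℝ} (hc : 0 ≤ c) (i : ι) :
    min (c i) 1 ≤ gridAbove N c i ∧ gridAbove N c i ≤ 1 ∧
      gridAbove N c i ≤ min (c i) 1 + 1 / N := by
  have hN' : (0 : ℝ) < N := by exact_mod_cast hN
  have h0 := mul_nonneg hN'.le (hc i)
  have h1 := Nat.floor_le h0
  have h2 := Nat.lt_floor_add_one ((N : ℝ) * c i)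
  simp only [gridAbove, gridPoint, Nat.cast_min, Nat.cast_add, Nat.cast_one]
  refine ⟨?_, ?_, ?_⟩
  · rw [le_div_iff₀ hN', le_min_iff]
    exact ⟨by nlinarith [min_le_right (c i) 1], by nlinarith [min_le_left (c i) 1]⟩
  · rw [div_le_one hN']
    exact min_le_left _ _
  · rw [div_le_iff₀ hN', add_mul, one_div_mul_cancel hN'.ne']
    rcases le_total (c i) 1 with h | h
    · rw [min_eq_left h]
      exact (min_le_right _ _).trans (by linarith)
    · rw [min_eq_right h]
      exact (min_le_left _ _).trans (by linarith)

end Grid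

/-! ### Existence and total variation of the generated measure -/

section Existence

variable {ι : Type*} [Fintype ι]

/-- The limit of the grid measures along an ultrafilter. -/
lemma exists_limit_gridMeasure [DecidableEq ι] (f : (ι → ℝ) → ℝ) (hv : varNorm f < ∞)
    (U : Ultrafilter ℕ) (g : (ι → ℝ) → ℝ) (hg : g = f ∨ g = fun x => -f x) :
    ∃ P : FiniteMeasure (ι → ℝ), Tendsto (fun n => gridFiniteMeasure g (n + 1)) U (𝓝 P) := by
  -- Measures carried by the compact cube with mass at most the variation norm form a weakly compact
  -- set, so the ultrafilter has a limit there.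
  have hcomp := isCompact_setOfPred_finiteMeasure_le_of_isCompact (E := ι → ℝ) (varNorm f).toNNReal
    (isCompact_Icc (a := (0 : ι → ℝ)) (b := 1))
  obtain ⟨P, -, hP⟩ := hcomp.ultrafilter_le_nhds (U.map fun n =>
    gridFiniteMeasure g (n + 1)) (by
      refine le_principal_iff.2 ?_
      refine Filter.mem_map.2 (Filter.mem_of_superset Filter.univ_mem fun n _ => ⟨?_, ?_⟩)
      · rw [← ENNReal.coe_le_coe, ENNReal.coe_toNNReal hv.ne, FiniteMeasure.ennreal_mass,
          coe_gridFiniteMeasure]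
        have h := gridMeasure_univ_add f n.succ_pos
        rcases hg with rfl | rfl
        · exact le_self_add.trans h
        · exact le_add_self.trans h
      · rw [FiniteMeasure.null_iff_toMeasure_null, coe_gridFiniteMeasure]
        exact gridMeasure_compl_Icc g (n + 1))
  exact ⟨P, hP⟩

/-- A right-continuous function of bounded variation on the cube is, up to lower dimensional terms,
the difference of the distribution functions of two finite measures whose total mass is at most the
variation. -/
theorem exists_measures_gdiff {f : (ι → ℝ) → ℝ} (hf : IsCadlag f) (hv : varNorm f < ∞) :
    ∃ P N : Measure (ι → ℝ), IsFiniteMeasure P ∧ IsFiniteMeasure N ∧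
      P Set.univ + N Set.univ ≤ varNorm f ∧
      ∀ a b : ι → ℝ, 0 ≤ a → a ≤ b → b ≤ 1 → P.real (box a b) - N.real (box a b) = gdiff f a b := by
  classical
  -- One ultrafilter serves both sequences of measures, so the differences converge along it too.
  let U : Ultrafilter ℕ := hyperfilter ℕ
  have hU : (U : Filter ℕ) ≤ atTop := Nat.hyperfilter_le_atTop
  obtain ⟨P, hP⟩ := exists_limit_gridMeasure f hv U f (Or.inl rfl)
  obtain ⟨N, hN⟩ := exists_limit_gridMeasure f hv U (fun x => -f x) (Or.inr rfl)
  have hnull : ∀ c : ι → ℝ, 0 ≤ c → (P + N : Measure (ι → ℝ)) (frontier (Set.Iic c)) = 0 →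
      (P : Measure (ι → ℝ)).real (Set.Iic c) - (N : Measure (ι → ℝ)).real (Set.Iic c) =
        gdiff f 0 (c ⊓ 1) := by
    intro c hc h0
    rw [Measure.add_apply, add_eq_zero] at h0
    have h1 := (tendsto_real_of_null_frontier hP h0.1).sub (tendsto_real_of_null_frontier hN h0.2)
    simp only [coe_gridFiniteMeasure, gridMeasure_Iic_sub f (Nat.succ_pos _) hc] at h1
    refine tendsto_nhds_unique h1 (Tendsto.mono_left ?_ hU)
    have hb := fun n : ℕ => gridAbove_bounds n.succ_pos hc
    refine hf.tendsto_gdiff ⟨le_inf hc zero_le_one, inf_le_right⟩ (fun n i => (hb n i).1)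
      (fun n i => (hb n i).2.1) (tendsto_pi_nhds.2 fun i => ?_)
    refine tendsto_of_tendsto_of_tendsto_of_le_of_le tendsto_const_nhds
      (h := fun n : ℕ => min (c i) 1 + 1 / ((n + 1 : ℕ) : ℝ)) ?_ (fun n => (hb n i).1)
      fun n => (hb n i).2.2
    simpa using tendsto_const_nhds.add (tendsto_one_div_add_atTop_nhds_zero_nat (𝕜 := ℝ))
  -- Both sides are right-continuous, so the identity extends from points with null boundary. The
  -- approximating points may leave the cube, hence the truncation at 1 in `hnull`.
  have hIic : ∀ c ∈ Set.Icc (0 : ι → ℝ) 1,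
      (P : Measure (ι → ℝ)).real (Set.Iic c) - (N : Measure (ι → ℝ)).real (Set.Iic c) =
        gdiff f 0 c := by
    intro b hb
    obtain ⟨c, hbc, hc, hc0⟩ := exists_seq_null_faces (P + N : Measure (ι → ℝ)) b
    have h1 := (tendsto_measureReal_Iic (P : Measure (ι → ℝ)) hbc hc).sub
      (tendsto_measureReal_Iic (N : Measure (ι → ℝ)) hbc hc)
    refine tendsto_nhds_unique h1 ?_
    simp only [fun n => hnull (c n) (hb.1.trans (hbc n)) (hc0 n)]
    refine hf.tendsto_gdiff hb (fun n => le_inf (hbc n) hb.2) (fun n => inf_le_right) ?_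
    refine tendsto_pi_nhds.2 fun i => ?_
    have := (tendsto_pi_nhds.1 hc i).min (tendsto_const_nhds (x := (1 : ℝ)))
    rwa [min_eq_left (show b i ≤ 1 from hb.2 i)] at this
  refine ⟨P, N, inferInstance, inferInstance, ?_, fun a b ha hab hb => ?_⟩
  · have h1 := ((FiniteMeasure.continuous_mass.tendsto P).comp hP).add
      ((FiniteMeasure.continuous_mass.tendsto N).comp hN)
    have h2 : P.mass + N.mass ≤ (varNorm f).toNNReal := by
      refine le_of_tendsto h1 (Eventually.of_forall fun n => ?_)
      rw [← ENNReal.coe_le_coe, ENNReal.coe_toNNReal hv.ne, ENNReal.coe_add]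
      simp only [Function.comp, FiniteMeasure.ennreal_mass, coe_gridFiniteMeasure]
      exact gridMeasure_univ_add f n.succ_pos
    rw [← ENNReal.coe_le_coe, ENNReal.coe_toNNReal hv.ne, ENNReal.coe_add] at h2
    simpa only [FiniteMeasure.ennreal_mass] using h2
  · rw [measureReal_box _ hab, measureReal_box _ hab, ← gdiff_gdiff f 0 a b]
    have h1 : ∀ u v : (ι → ℝ) → ℝ, gdiff u a b - gdiff v a b = gdiff (fun c => u c - v c) a b := by
      intro u v
      simp only [gdiff_eq_sum_corner, ← Finset.sum_sub_distrib, mul_sub]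
    rw [h1]
    refine gdiff_congr fun x hx => hIic x ⟨fun i => ?_, fun i => ?_⟩
    · rcases hx i with h | h <;> rw [h]
      · exact ha i
      · exact (ha i).trans (hab i)
    · rcases hx i with h | h <;> rw [h]
      · exact (hab i).trans (hb i)
      · exact hb i

/-- The limit measures live on the closed cube and may charge its lower faces; restricting to `box 0
1` removes this mass without affecting the boxes inside or increasing the total mass. -/
theorem exists_isGeneratedBy {f : (ι → ℝ) → ℝ} (hf : IsCadlag f) (hv : varNorm f < ∞) :
    ∃ ν, IsGeneratedBy ν f ∧ ν.totalVariation Set.univ ≤ varNorm f := by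
  obtain ⟨P, N, _, _, hPN, h⟩ := exists_measures_gdiff hf hv
  refine ⟨(P.restrict (box 0 1)).toSignedMeasure - (N.restrict (box 0 1)).toSignedMeasure,
    ⟨fun a b ha hab hb => ?_, fun A hA hd => ?_⟩, ?_⟩
  · rw [← h a b ha hab hb, _root_.sub_apply,
      Measure.toSignedMeasure_apply_measurable (measurableSet_box a b),
      Measure.toSignedMeasure_apply_measurable (measurableSet_box a b)]
    simp only [Measure.real, Measure.restrict_apply (measurableSet_box a b),
      Set.inter_eq_left.2 (box_mono ha hb)]
  · rw [_root_.sub_apply, Measure.toSignedMeasure_apply_measurable hA,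
      Measure.toSignedMeasure_apply_measurable hA]
    simp [Measure.real, Measure.restrict_apply hA, hd.inter_eq]
  · rw [SignedMeasure.totalVariation_eq_variation]
    refine le_trans (VectorMeasure.variation_sub_le Set.univ) ?_
    simp only [Measure.add_apply, Measure.variation_toSignedMeasure]
    exact le_trans (add_le_add (Measure.restrict_apply_le _ _) (Measure.restrict_apply_le _ _)) hPN

theorem isGeneratedBy_dMeasure {f : (ι → ℝ) → ℝ} (hf : IsCadlag f) (hv : varNorm f < ∞) :
    IsGeneratedBy (dMeasure f) f := by
  have h : ∃ ν, IsGeneratedBy ν f := (exists_isGeneratedBy hf hv).imp fun _ h => h.1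
  rw [dMeasure, dif_pos h]
  exact h.choose_spec

/-- For each box `J` of a partition the difference is `ν J`, bounded by the total variation of `J`,
which is additive over disjoint boxes. -/
lemma IsGeneratedBy.varNorm_le {f : (ι → ℝ) → ℝ} {ν : SignedMeasure (ι → ℝ)}
    (h : IsGeneratedBy ν f) : varNorm f ≤ ν.totalVariation (box 0 1) := by
  refine iSup_le fun π => ?_
  have hbox : ∀ J : BoxIntegral.Box ι, (J : Set (ι → ℝ)) = box J.lower J.upper := fun J =>
    J.coe_eq_pi
  have h1 : ∀ J ∈ π.boxes, ENNReal.ofReal |gdiff f J.lower J.upper| ≤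
      ν.totalVariation (J : Set (ι → ℝ)) := by
    intro J hJ
    have hle := BoxIntegral.Box.le_iff_bounds.1 (π.le_of_mem hJ)
    rw [← h.1 J.lower J.upper hle.1 (fun i => (J.lower_lt_upper i).le) hle.2, ← hbox,
      ← Real.enorm_eq_ofReal_abs]
    exact ν.enorm_le_totalVariation _
  refine (Finset.sum_le_sum h1).trans ?_
  rw [← measure_biUnion_finset (fun I hI J hJ hne => π.pairwiseDisjoint hI hJ hne)
    fun J _ => J.measurableSet_coe]
  refine measure_mono (Set.iUnion₂_subset fun J hJ => ?_)
  have hle := BoxIntegral.Box.le_iff_bounds.1 (π.le_of_mem hJ)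
  rw [hbox]
  exact box_mono hle.1 hle.2

/-- The total variation of the measure generated by `f` is the variation norm of `f`. -/
theorem totalVariation_dMeasure {f : (ι → ℝ) → ℝ} (hf : IsCadlag f) (hv : varNorm f < ∞) :
    (dMeasure f).totalVariation (box 0 1) = varNorm f := by
  have h := isGeneratedBy_dMeasure hf hv
  refine le_antisymm ?_ h.varNorm_le
  -- The mass bound is known only for the constructed measure; uniqueness transfers it to `dMeasure
  -- f`.
  obtain ⟨ν, hν, hle⟩ := exists_isGeneratedBy hf hv
  rw [h.unique hν]
  exact (measure_mono (Set.subset_univ _)).trans hle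

end Existence

/-! ### One-dimensional splines -/

section TruncatedPower

/-- The truncated power `(x - u)₊ʲ / j!`. -/
noncomputable def truncPow (j : ℕ) (u x : ℝ) : ℝ := if u ≤ x then (x - u) ^ j / j.factorial else 0

lemma truncPow_nonneg (j : ℕ) (u x : ℝ) : 0 ≤ truncPow j u x := by
  unfold truncPow
  split_ifs with h
  · have := sub_nonneg.2 h
    positivity
  · exact le_rfl

lemma truncPow_le_one (j : ℕ) {u x : ℝ} (hu : 0 ≤ u) (hx : x ≤ 1) : truncPow j u x ≤ 1 := by
  unfold truncPow
  split_ifs with h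
  · refine div_le_one_of_le₀ ?_ (Nat.cast_nonneg _)
    exact (pow_le_one₀ (by linarith) (by linarith)).trans
      (by exact_mod_cast Nat.one_le_iff_ne_zero.2 j.factorial_ne_zero)
  · exact zero_le_one

lemma measurable_truncPow (j : ℕ) : Measurable fun p : ℝ × ℝ => truncPow j p.1 p.2 :=
  Measurable.ite (measurableSet_le measurable_fst measurable_snd) (by fun_prop) measurable_const

lemma integral_truncPow_left (j : ℕ) (u x : ℝ) :
    ∫ v in Set.Ioc u x, truncPow j v x = truncPow (j + 1) u x := by
  by_cases h : u ≤ x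
  · have h1 : ∫ v in Set.Ioc u x, truncPow j v x =
        ∫ v in Set.Ioc u x, (x - v) ^ j / j.factorial :=
      setIntegral_congr_fun measurableSet_Ioc fun v hv => by simp [truncPow, hv.2]
    rw [h1, ← intervalIntegral.integral_of_le h,
      intervalIntegral.integral_comp_sub_left (fun v => v ^ j / (j.factorial : ℝ)) x]
    simp only [intervalIntegral.integral_div, integral_pow, truncPow, h, if_true, sub_self]
    rw [Nat.factorial_succ]
    push_cast
    field_simp
    ring
  · rw [Set.Ioc_eq_empty (fun h' => h h'.le)]
    simp [truncPow, h]

lemma integral_truncPow_right (j : ℕ) {u : ℝ} (hu : 0 ≤ u) (x : ℝ) :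
    ∫ v in Set.Ioc 0 x, truncPow j u v = truncPow (j + 1) u x := by
  by_cases h : u ≤ x
  -- The integrand vanishes below `u`, but for `j = 0` it is 1 at `v = u`; that single point is
  -- null.
  · have h1 : ∫ v in Set.Ioc 0 x, truncPow j u v = ∫ v in Set.Ioc u x, truncPow j u v := by
      refine setIntegral_eq_of_subset_of_ae_sdiff_eq_zero measurableSet_Ioc.nullMeasurableSet
        (Set.Ioc_subset_Ioc_left hu) ?_
      filter_upwards [compl_mem_ae_iff.2 (measure_singleton u)] with v hv hv'
      refine if_neg fun huv => hv'.2 ⟨lt_of_le_of_ne huv fun h => hv h.symm, hv'.1.2⟩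
    have h2 : ∫ v in Set.Ioc u x, truncPow j u v =
        ∫ v in Set.Ioc u x, (v - u) ^ j / j.factorial :=
      setIntegral_congr_fun measurableSet_Ioc fun v hv => by simp [truncPow, hv.1.le]
    rw [h1, h2, ← intervalIntegral.integral_of_le h,
      intervalIntegral.integral_comp_sub_right (fun v => v ^ j / (j.factorial : ℝ)) u]
    simp only [intervalIntegral.integral_div, integral_pow, truncPow, h, if_true, sub_self]
    rw [Nat.factorial_succ]
    push_cast
    field_simp
    ring
  · rw [setIntegral_congr_fun (g := fun _ => (0 : ℝ)) measurableSet_Ioc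
      fun v hv => by simp [truncPow, not_le.2 (hv.2.trans_lt (not_le.1 h))]]
    simp [truncPow, h]

end TruncatedPower

/-! ### Product structure of splines and primitives -/

section Primitive

lemma box_subset_Icc {ι : Type*} (a b : ι → ℝ) : box a b ⊆ Set.Icc a b :=
  fun _ hy => ⟨fun i => (hy i trivial).1.le, fun i => (hy i trivial).2⟩

variable {ι : Type*} [Fintype ι]

lemma setIntegral_box_prod (a b : ι → ℝ) (g : ι → ℝ → ℝ) :
    ∫ v in box a b, ∏ i, g i (v i) = ∏ i, ∫ t in Set.Ioc (a i) (b i), g i t := by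
  rw [box, volume_pi, Measure.restrict_pi_pi]
  exact integral_fintype_prod_eq_prod g

lemma spline_eq_prod (j : ℕ) (u x : ι → ℝ) : spline j u x = ∏ i, truncPow j (u i) (x i) := by
  classical
  induction j generalizing u with
  | zero =>
    simp only [spline, truncPow, pow_zero, Nat.factorial_zero, Nat.cast_one, div_one]
    rw [Finset.prod_ite_zero]
    simp [Pi.le_def]
  | succ j ih =>
    simp only [spline, ih]
    rw [setIntegral_box_prod u x fun i t => truncPow j t (x i)]
    simp only [integral_truncPow_left]

/-- The definition integrates over the knot; the explicit product formula shows that integrating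
over the argument raises the order in the same way. Fubini needs this second form. -/
lemma setIntegral_spline (j : ℕ) {u : ι → ℝ} (hu : 0 ≤ u) (x : ι → ℝ) :
    ∫ v in box 0 x, spline j u v = spline (j + 1) u x := by
  simp only [spline_eq_prod]
  rw [setIntegral_box_prod 0 x fun i t => truncPow j (u i) t]
  exact Finset.prod_congr rfl fun i _ => integral_truncPow_right j (hu i) (x i)

lemma spline_eq_zero (j : ℕ) {u x : ι → ℝ} (h : ¬ u ≤ x) : spline j u x = 0 := by
  rw [spline_eq_prod]
  obtain ⟨i, hi⟩ := not_forall.1 h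
  exact Finset.prod_eq_zero (Finset.mem_univ i) (by rw [truncPow, if_neg hi])

lemma abs_spline_le_one (j : ℕ) {u x : ι → ℝ} (hu : 0 ≤ u) (hx : x ≤ 1) : |spline j u x| ≤ 1 := by
  rw [spline_eq_prod, Finset.abs_prod]
  refine Finset.prod_le_one (fun i _ => abs_nonneg _) fun i _ => ?_
  rw [abs_of_nonneg (truncPow_nonneg _ _ _)]
  exact truncPow_le_one j (hu i) (hx i)

lemma measurable_spline (j : ℕ) :
    Measurable fun p : (ι → ℝ) × (ι → ℝ) => spline j p.1 p.2 := by
  simp only [spline_eq_prod]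
  refine Finset.measurable_fun_prod _ fun i _ => ?_
  exact (measurable_truncPow j).comp (f := fun p : (ι → ℝ) × (ι → ℝ) => (p.1 i, p.2 i))
    (by fun_prop)

lemma primitive_congr (j : ℕ) {f g : (ι → ℝ) → ℝ} {x : ι → ℝ} (hx : 0 ≤ x)
    (h : ∀ y ∈ Set.Icc 0 x, f y = g y) : primitive j f x = primitive j g x := by
  induction j generalizing x with
  | zero => exact h x ⟨hx, le_rfl⟩
  | succ j ih =>
    refine setIntegral_congr_fun (measurableSet_box 0 x) fun y hy => ?_
    have hy' := box_subset_Icc _ _ hy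
    exact ih hy'.1 fun z hz => h z ⟨hz.1, hz.2.trans hy'.2⟩

/-- The recursion adds an outermost integral, whereas replacing a difference by the integral of a
density adds an innermost one. -/
lemma primitive_setIntegral (j : ℕ) (f : (ι → ℝ) → ℝ) (x : ι → ℝ) :
    primitive j (fun y => ∫ z in box 0 y, f z) x = primitive (j + 1) f x := by
  induction j generalizing x with
  | zero => rfl
  | succ j ih => simp only [primitive, ih]

lemma primitive_one (j : ℕ) {x : ι → ℝ} (hx : 0 ≤ x) :
    primitive j (fun _ => 1) x = spline j 0 x := by
  induction j generalizing x with
  | zero => simp [primitive, spline, hx]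
  | succ j ih =>
    rw [← setIntegral_spline j le_rfl]
    exact setIntegral_congr_fun (measurableSet_box 0 x) fun y hy =>
      ih (box_subset_Icc _ _ hy).1

lemma setIntegral_box_mul {κ κ' : Type*} [Fintype κ] [Fintype κ'] (e : κ ⊕ κ' ≃ ι)
    (G : (κ → ℝ) → ℝ) (H : (κ' → ℝ) → ℝ) (x : ι → ℝ) :
    ∫ y in box 0 x, G (fun i => y (e (.inl i))) * H (fun i => y (e (.inr i))) =
      (∫ y in box 0 fun i => x (e (.inl i)), G y) * ∫ y in box 0 fun i => x (e (.inr i)), H y := by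
  let φ : ((κ → ℝ) × (κ' → ℝ)) ≃ᵐ (ι → ℝ) :=
    (MeasurableEquiv.sumPiEquivProdPi fun _ : κ ⊕ κ' => ℝ).symm.trans
      (MeasurableEquiv.piCongrLeft (fun _ => ℝ) e)
  have hφ : MeasurePreserving φ (volume.prod volume) volume :=
    (volume_measurePreserving_piCongrLeft (fun _ => ℝ) e).comp
      (volume_measurePreserving_sumPiEquivProdPi_symm fun _ : κ ⊕ κ' => ℝ)
  have hl : ∀ p i, φ p (e (.inl i)) = p.1 i := fun p i =>
    Equiv.piCongrLeft_apply_apply (fun _ => ℝ) e _ (.inl i)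
  have hr : ∀ p i, φ p (e (.inr i)) = p.2 i := fun p i =>
    Equiv.piCongrLeft_apply_apply (fun _ => ℝ) e _ (.inr i)
  rw [← hφ.setIntegral_preimage_emb φ.measurableEmbedding]
  simp only [hl, hr]
  rw [← setIntegral_prod_mul]
  congr 2
  ext p
  simp only [box, Set.mem_preimage, Set.mem_univ_pi, Set.mem_prod]
  rw [← e.forall_congr_right, Sum.forall]
  simp only [hl, hr]
  rfl

/-- Separated variables stay separated under integration over boxes. With `H = 1` the second factor
becomes the spline with knot 0, the source of the edge factors. -/
lemma primitive_mul {κ κ' : Type*} [Fintype κ] [Fintype κ'] (e : κ ⊕ κ' ≃ ι) (j : ℕ)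
    (G : (κ → ℝ) → ℝ) (H : (κ' → ℝ) → ℝ) (x : ι → ℝ) :
    primitive j (fun y => G (fun i => y (e (.inl i))) * H (fun i => y (e (.inr i)))) x =
      primitive j G (fun i => x (e (.inl i))) * primitive j H (fun i => x (e (.inr i))) := by
  induction j generalizing x with
  | zero => rfl
  | succ j ih =>
    simp only [primitive, ih]
    exact setIntegral_box_mul e (primitive j G) (primitive j H) x

end Primitive

/-! ### Integrability under iterated primitives, and Fubini -/

section BoundedMeasurable

variable {ι : Type*}

/-- `f` agrees on the unit cube with a bounded measurable function. -/
def IsBddMeas (f : (ι → ℝ) → ℝ) : Prop :=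
  ∃ g : (ι → ℝ) → ℝ, Measurable g ∧ (∃ C, ∀ x, |g x| ≤ C) ∧ ∀ x ∈ Set.Icc (0 : ι → ℝ) 1, f x = g x

lemma isBddMeas_const (c : ℝ) : IsBddMeas fun _ : ι → ℝ => c :=
  ⟨fun _ => c, measurable_const, ⟨|c|, fun _ => le_rfl⟩, fun _ _ => rfl⟩

lemma IsBddMeas.congr {f g : (ι → ℝ) → ℝ} (hf : IsBddMeas f)
    (h : ∀ x ∈ Set.Icc (0 : ι → ℝ) 1, g x = f x) : IsBddMeas g := by
  obtain ⟨f', hm, hC, hf'⟩ := hf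
  exact ⟨f', hm, hC, fun x hx => (h x hx).trans (hf' x hx)⟩

lemma IsBddMeas.sub {f g : (ι → ℝ) → ℝ} (hf : IsBddMeas f) (hg : IsBddMeas g) :
    IsBddMeas fun x => f x - g x := by
  obtain ⟨f', hfm, ⟨C, hC⟩, hf'⟩ := hf
  obtain ⟨g', hgm, ⟨D, hD⟩, hg'⟩ := hg
  exact ⟨fun x => f' x - g' x, hfm.sub hgm, ⟨C + D, fun x => (abs_sub _ _).trans
    (add_le_add (hC x) (hD x))⟩, fun x hx => congrArg₂ _ (hf' x hx) (hg' x hx)⟩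

lemma IsBddMeas.comp {κ : Type*} {f : (κ → ℝ) → ℝ} (hf : IsBddMeas f) (l : κ → ι) :
    IsBddMeas fun y : ι → ℝ => f fun i => y (l i) := by
  obtain ⟨g, hm, ⟨C, hC⟩, hg⟩ := hf
  refine ⟨fun y => g fun i => y (l i), hm.comp (by fun_prop), ⟨C, fun y => hC _⟩, fun y hy => ?_⟩
  exact hg _ ⟨fun i => hy.1 (l i), fun i => hy.2 (l i)⟩

variable [Fintype ι]

lemma integrable_of_bdd {Ω : Type*} [MeasurableSpace Ω] {P : Measure Ω} [IsFiniteMeasure P]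
    {g : Ω → ℝ} (hm : Measurable g) {C : ℝ} (hC : ∀ x, |g x| ≤ C) : Integrable g P :=
  Integrable.of_bound hm.aestronglyMeasurable C (ae_of_all _ hC)

lemma volume_box_ne_top (a b : ι → ℝ) : volume (box a b) ≠ ∞ :=
  measure_ne_top_of_subset (box_subset_Icc a b) (isCompact_Icc.measure_lt_top).ne

lemma IsBddMeas.integrableOn {f : (ι → ℝ) → ℝ} (hf : IsBddMeas f) {x : ι → ℝ} (hx : x ≤ 1) :
    IntegrableOn f (box 0 x) := by
  obtain ⟨g, hm, ⟨C, hC⟩, hg⟩ := hf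
  have : IsFiniteMeasure (volume.restrict (box 0 x)) :=
    ⟨by simpa using (volume_box_ne_top 0 x).lt_top⟩
  refine IntegrableOn.congr_fun (f := g) (integrable_of_bdd hm hC) (fun y hy => ?_)
    (measurableSet_box 0 x)
  have hy' := box_subset_Icc _ _ hy
  exact (hg y ⟨hy'.1, hy'.2.trans hx⟩).symm

lemma measurableSet_box_zero :
    MeasurableSet {p : (ι → ℝ) × (ι → ℝ) | p.2 ∈ box 0 p.1} := by
  have : {p : (ι → ℝ) × (ι → ℝ) | p.2 ∈ box 0 p.1} =
      ⋂ i, {p : (ι → ℝ) × (ι → ℝ) | (0 : ℝ) < p.2 i ∧ p.2 i ≤ p.1 i} := by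
    ext p
    simp [box]
  rw [this]
  refine MeasurableSet.iInter fun i => ?_
  have h1 : Measurable fun p : (ι → ℝ) × (ι → ℝ) => p.1 i := by fun_prop
  have h2 : Measurable fun p : (ι → ℝ) × (ι → ℝ) => p.2 i := by fun_prop
  exact (measurableSet_lt measurable_const h2).inter (measurableSet_le h2 h1)

lemma isBddMeas_setIntegral_box (P : Measure (ι → ℝ)) [IsFiniteMeasure P] {g : (ι → ℝ) → ℝ}
    (hm : Measurable g) {C : ℝ} (hC : ∀ x, |g x| ≤ C) :
    IsBddMeas fun x => ∫ y in box 0 x, g y ∂P := by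
  refine ⟨_, ?_, ⟨∫ y, |g y| ∂P, fun x => ?_⟩, fun x _ => rfl⟩
  · simp only [← integral_indicator (measurableSet_box 0 _)]
    refine (StronglyMeasurable.integral_prod_right
      (f := fun x y => (box 0 x).indicator g y) ?_).measurable
    have := (hm.comp (measurable_snd (α := ι → ℝ) (β := ι → ℝ))).indicator
      (measurableSet_box_zero (ι := ι))
    exact this.stronglyMeasurable
  · refine (abs_integral_le_integral_abs).trans ?_
    exact setIntegral_le_integral (integrable_of_bdd hm hC).abs (ae_of_all _ fun _ => abs_nonneg _)

lemma IsBddMeas.setIntegral {f : (ι → ℝ) → ℝ} (hf : IsBddMeas f) :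
    IsBddMeas fun x => ∫ y in box 0 x, f y := by
  obtain ⟨g, hm, ⟨C, hC⟩, hg⟩ := hf
  have : IsFiniteMeasure (volume.restrict (box (0 : ι → ℝ) 1)) :=
    ⟨by simpa using (volume_box_ne_top 0 1).lt_top⟩
  refine (isBddMeas_setIntegral_box (volume.restrict (box (0 : ι → ℝ) 1)) hm hC).congr
    fun x hx => ?_
  rw [Measure.restrict_restrict (measurableSet_box 0 x),
    Set.inter_eq_left.2 (box_mono le_rfl hx.2)]
  refine setIntegral_congr_fun (measurableSet_box 0 x) fun y hy => ?_
  have hy' := box_subset_Icc _ _ hy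
  exact hg y ⟨hy'.1, hy'.2.trans hx.2⟩

lemma IsBddMeas.primitive {f : (ι → ℝ) → ℝ} (hf : IsBddMeas f) (j : ℕ) :
    IsBddMeas (primitive j f) := by
  induction j with
  | zero => exact hf
  | succ j ih => exact ih.setIntegral

lemma primitive_sum {κ : Type*} (S : Finset κ) (c : κ → ℝ) {f : κ → (ι → ℝ) → ℝ}
    (hf : ∀ k ∈ S, IsBddMeas (f k)) (j : ℕ) {x : ι → ℝ} (hx : x ∈ Set.Icc (0 : ι → ℝ) 1) :
    primitive j (fun y => ∑ k ∈ S, c k * f k y) x = ∑ k ∈ S, c k * primitive j (f k) x := by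
  induction j generalizing x with
  | zero => rfl
  | succ j ih =>
    simp only [KSpline.primitive, ← integral_const_mul]
    rw [← integral_finsetSum _ fun k hk =>
      (((hf k hk).primitive j).integrableOn hx.2).const_mul (c k)]
    refine setIntegral_congr_fun (measurableSet_box 0 x) fun y hy => ?_
    have hy' := box_subset_Icc _ _ hy
    exact ih ⟨hy'.1, hy'.2.trans hx.2⟩

lemma primitive_sub {f g : (ι → ℝ) → ℝ} (hf : IsBddMeas f) (hg : IsBddMeas g) (j : ℕ) {x : ι → ℝ}
    (hx : x ∈ Set.Icc (0 : ι → ℝ) 1) :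
    primitive j (fun y => f y - g y) x = primitive j f x - primitive j g x := by
  -- The difference is the two-term combination with coefficients 1 and -1.
  have h := primitive_sum Finset.univ (fun b : Bool => if b then (1 : ℝ) else -1)
    (f := fun b => if b then f else g) (by rintro (_ | _) - <;> simpa) j hx
  simpa [← sub_eq_add_neg] using h

/-- The primitives of a distribution function are spline integrals. -/
lemma primitive_measureReal (P : Measure (ι → ℝ)) [IsFiniteMeasure P] (j : ℕ) {x : ι → ℝ}
    (hx : x ∈ Set.Icc (0 : ι → ℝ) 1) :
    primitive j (fun u => P.real (box 0 u)) x = ∫ y in box 0 1, spline j y x ∂P := by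
  induction j generalizing x with
  | zero =>
    have h : ∀ y ∈ box (0 : ι → ℝ) 1, spline 0 y x = (box 0 x).indicator (fun _ => (1 : ℝ)) y := by
      classical
      intro y hy
      have : y ≤ x ↔ y ∈ box 0 x :=
        ⟨fun h i _ => ⟨(hy i trivial).1, h i⟩, fun h i => (h i trivial).2⟩
      simp only [spline, Set.indicator_apply, this]
    rw [setIntegral_congr_fun (measurableSet_box 0 1) h,
      integral_indicator_const _ (measurableSet_box 0 x)]
    simp [KSpline.primitive, Measure.real, Measure.restrict_apply (measurableSet_box 0 x),
      Set.inter_eq_left.2 (box_mono (le_refl (0 : ι → ℝ)) hx.2)]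
  | succ j ih =>
    have hfin : IsFiniteMeasure (volume.restrict (box 0 x)) :=
      ⟨by simpa using (volume_box_ne_top 0 x).lt_top⟩
    have h1 : KSpline.primitive (j + 1) (fun u => P.real (box 0 u)) x =
        ∫ v in box 0 x, ∫ y in box 0 1, spline j y v ∂P := by
      refine setIntegral_congr_fun (measurableSet_box 0 x) fun v hv => ?_
      have hv' := box_subset_Icc _ _ hv
      exact ih ⟨hv'.1, hv'.2.trans hx.2⟩
    -- After the swap the inner integral runs over the argument of the spline and raises its order;
    -- Fubini applies since the spline is bounded by 1 on the cube.
    rw [h1, integral_integral_swap]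
    · refine setIntegral_congr_fun (measurableSet_box 0 1) fun y hy => ?_
      exact setIntegral_spline j (box_subset_Icc _ _ hy).1 x
    · refine Integrable.of_bound
        ((measurable_spline j).comp measurable_swap).aestronglyMeasurable 1 ?_
      rw [Measure.prod_restrict]
      refine (ae_restrict_iff' ((measurableSet_box 0 x).prod (measurableSet_box 0 1))).2
        (ae_of_all _ fun p hp => ?_)
      exact abs_spline_le_one j (box_subset_Icc _ _ hp.2).1
        ((box_subset_Icc _ _ hp.1).2.trans hx.2)

end BoundedMeasurable

/-! ### Integration against signed measures -/

section SignedMeasures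

variable {ι : Type*} [Fintype ι]

/-- A signed measure is the difference of two finite measures. -/
lemma exists_eq_sub {Ω : Type*} [MeasurableSpace Ω] (ν : SignedMeasure Ω) :
    ∃ P N : Measure Ω, ∃ (_ : IsFiniteMeasure P) (_ : IsFiniteMeasure N),
      ν = P.toSignedMeasure - N.toSignedMeasure :=
  ⟨_, _, ν.toJordanDecomposition.posPart_finite, ν.toJordanDecomposition.negPart_finite,
    ν.toSignedMeasure_toJordanDecomposition.symm⟩

lemma sub_toSignedMeasure_apply {Ω : Type*} [MeasurableSpace Ω] (P N : Measure Ω)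
    [IsFiniteMeasure P] [IsFiniteMeasure N] {A : Set Ω} (hA : MeasurableSet A) :
    (P.toSignedMeasure - N.toSignedMeasure) A = P.real A - N.real A := by
  rw [_root_.sub_apply, Measure.toSignedMeasure_apply_measurable hA,
    Measure.toSignedMeasure_apply_measurable hA]

lemma isBddMeas_measureReal_box (P : Measure (ι → ℝ)) [IsFiniteMeasure P] :
    IsBddMeas fun u => P.real (box 0 u) := by
  simpa using isBddMeas_setIntegral_box P (measurable_const (a := (1 : ℝ))) (C := 1) (by simp)

lemma isBddMeas_signedMeasure_box (ν : SignedMeasure (ι → ℝ)) :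
    IsBddMeas fun u => ν (box 0 u) := by
  obtain ⟨P, N, _, _, rfl⟩ := exists_eq_sub ν
  simp only [sub_toSignedMeasure_apply P N (measurableSet_box 0 _)]
  exact (isBddMeas_measureReal_box P).sub (isBddMeas_measureReal_box N)

/-- Nothing is assumed about `f` itself; regularity of its differences comes from their being masses
of boxes. -/
lemma IsGeneratedBy.isBddMeas {f : (ι → ℝ) → ℝ} {ν : SignedMeasure (ι → ℝ)}
    (h : IsGeneratedBy ν f) : IsBddMeas fun u => gdiff f 0 u :=
  (isBddMeas_signedMeasure_box ν).congr fun u hu => (h.1 0 u le_rfl hu.1 hu.2).symm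

lemma vectorIntegral_sub_toSignedMeasure {Ω : Type*} [MeasurableSpace Ω] (P N : Measure Ω)
    [IsFiniteMeasure P] [IsFiniteMeasure N] {B : Set Ω} (hB : MeasurableSet B) {g : Ω → ℝ}
    (hP : IntegrableOn g B P) (hN : IntegrableOn g B N) :
    ∫ᵛ u in B, g u ∂•(P.toSignedMeasure - N.toSignedMeasure) =
      (∫ u in B, g u ∂P) - ∫ u in B, g u ∂N := by
  have h1 : (P.toSignedMeasure - N.toSignedMeasure).restrict B =
      (P.restrict B).toSignedMeasure - (N.restrict B).toSignedMeasure := by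
    ext A hA
    rw [VectorMeasure.restrict_apply _ hB hA, sub_toSignedMeasure_apply _ _ (hA.inter hB),
      sub_toSignedMeasure_apply _ _ hA]
    simp only [Measure.real, Measure.restrict_apply hA]
  have h2 : (ContinuousLinearMap.lsmul ℝ ℝ : ℝ →L[ℝ] ℝ →L[ℝ] ℝ) =
      (ContinuousLinearMap.lsmul ℝ ℝ : ℝ →L[ℝ] ℝ →L[ℝ] ℝ).flip := by
    ext
    simp
  rw [h1, VectorMeasure.integral_sub_vectorMeasure, h2, VectorMeasure.integral_toSignedMeasure,
    VectorMeasure.integral_toSignedMeasure]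
  · simpa [VectorMeasure.Integrable] using hP.integrable
  · simpa [VectorMeasure.Integrable] using hN.integrable

/-- The primitives of the distribution function of a signed measure are spline integrals. -/
lemma vectorIntegral_spline (ν : SignedMeasure (ι → ℝ)) (j : ℕ) {x : ι → ℝ}
    (hx : x ∈ Set.Icc (0 : ι → ℝ) 1) {B : Set (ι → ℝ)} (hB : MeasurableSet B)
    (hB1 : B ⊆ box 0 1) (hBx : box 0 x ⊆ B) :
    ∫ᵛ u in B, spline j u x ∂•ν = primitive j (fun u => ν (box 0 u)) x := by
  obtain ⟨P, N, _, _, rfl⟩ := exists_eq_sub ν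
  have hm : Measurable fun u => spline j u x :=
    (measurable_spline j).comp (measurable_id.prodMk measurable_const)
  have hint : ∀ M : Measure (ι → ℝ), [IsFiniteMeasure M] →
      IntegrableOn (fun u => spline j u x) B M := fun M _ => by
    refine Integrable.of_bound hm.aestronglyMeasurable 1 ?_
    exact (ae_restrict_iff' hB).2 (ae_of_all _ fun u hu =>
      abs_spline_le_one j (box_subset_Icc _ _ (hB1 hu)).1 hx.2)
  have hset : ∀ M : Measure (ι → ℝ), [IsFiniteMeasure M] →
      ∫ u in B, spline j u x ∂M = primitive j (fun u => M.real (box 0 u)) x := fun M _ => by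
    rw [primitive_measureReal M j hx]
    refine (setIntegral_eq_of_subset_of_forall_sdiff_eq_zero (measurableSet_box 0 1) hB1
      fun u hu => ?_).symm
    -- A knot in `(0, 1]` outside `B` is not below `x`, so its spline vanishes at `x`. Hence both
    -- domains of integration in the theorem give the same value.
    exact spline_eq_zero j fun hux => hu.2 (hBx fun i _ => ⟨(hu.1 i trivial).1, hux i⟩)
  rw [vectorIntegral_sub_toSignedMeasure P N hB (hint P) (hint N), hset, hset,
    ← primitive_sub (isBddMeas_measureReal_box P) (isBddMeas_measureReal_box N) j hx]
  simp only [sub_toSignedMeasure_apply P N (measurableSet_box 0 _)]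

end SignedMeasures

/-! ### Extending nested chains by one set -/

section Chains

variable {d n : ℕ}

lemma mem_chains {s : Fin n → Finset (Fin d)} : s ∈ chains d n ↔ Antitone s := by
  simp [chains]

/-- The chain `(s_1, …, s_n, t)`. -/
def snocChain (s : Fin n → Finset (Fin d)) (t : Finset (Fin d)) : Fin (n + 1) → Finset (Fin d) :=
  Fin.snoc (α := fun _ => Finset (Fin d)) s t

@[simp]
lemma snocChain_last (s : Fin n → Finset (Fin d)) (t : Finset (Fin d)) :
    snocChain s t (Fin.last n) = t := by
  simp [snocChain]

@[simp]
lemma snocChain_castSucc (s : Fin n → Finset (Fin d)) (t : Finset (Fin d)) (i : Fin n) :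
    snocChain s t i.castSucc = s i := by
  simp [snocChain]

lemma snocChain_mk (s : Fin n → Finset (Fin d)) (t : Finset (Fin d)) {i : ℕ} (hi : i < n)
    (hi' : i < n + 1) : snocChain s t ⟨i, hi'⟩ = s ⟨i, hi⟩ :=
  snocChain_castSucc s t ⟨i, hi⟩

lemma snocChain_mem_chains {s : Fin (n + 1) → Finset (Fin d)} {t : Finset (Fin d)} :
    snocChain s t ∈ chains d (n + 2) ↔ s ∈ chains d (n + 1) ∧ t ⊆ s (Fin.last n) := by
  rw [mem_chains, mem_chains, Fin.antitone_iff_succ_le, Fin.antitone_iff_succ_le,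
    Fin.forall_fin_succ']
  simp only [Fin.succ_castSucc, snocChain_castSucc, Fin.succ_last, snocChain_last]

lemma sum_chains_succ (F : (Fin (n + 2) → Finset (Fin d)) → ℝ) :
    ∑ s ∈ chains d (n + 2), F s =
      ∑ s ∈ chains d (n + 1), ∑ t ∈ (s (Fin.last n)).powerset, F (snocChain s t) := by
  rw [Finset.sum_sigma']
  have h : ∀ s : Fin (n + 2) → Finset (Fin d),
      snocChain (Fin.init s) (s (Fin.last (n + 1))) = s := fun s => Fin.snoc_init_self s
  refine (Finset.sum_bij' (fun p _ => snocChain p.1 p.2)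
    (fun s _ => ⟨Fin.init s, s (Fin.last (n + 1))⟩) ?_ ?_ ?_ ?_ ?_).symm
  · rintro ⟨s, t⟩ hp
    simp only [Finset.mem_sigma, Finset.mem_powerset] at hp
    exact snocChain_mem_chains.2 hp
  · intro s hs
    rw [← h s] at hs
    simpa only [Finset.mem_sigma, Finset.mem_powerset] using snocChain_mem_chains.1 hs
  · rintro ⟨s, t⟩ _
    simp [snocChain]
  · exact fun s _ => h s
  · exact fun _ _ => rfl

lemma trunc_snocChain (s : Fin n → Finset (Fin d)) (t : Finset (Fin d)) {m : ℕ} (hm : m ≤ n) :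
    trunc (snocChain s t) m = trunc s m := by
  funext i
  have hi : (i : ℕ) < n := i.2.trans_le hm
  rw [trunc, trunc, dif_pos hi, dif_pos (hi.trans n.lt_succ_self), snocChain_mk s t hi]

lemma trunc_self (s : Fin n → Finset (Fin d)) : trunc s n = s := by
  funext i
  rw [trunc, dif_pos i.2]

lemma firstEmpty_eq {s : Fin n → Finset (Fin d)} {m : ℕ} (hm : m < n) (h : s ⟨m, hm⟩ = ∅)
    (hlt : ∀ i : Fin n, (i : ℕ) < m → s i ≠ ∅) : firstEmpty s = m :=
  IsLeast.csInf_eq ⟨⟨hm, h⟩, fun i ⟨hi, hi'⟩ => not_lt.1 fun him => hlt ⟨i, hi⟩ him hi'⟩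

lemma firstEmpty_spec {s : Fin n → Finset (Fin d)} (h : ∃ i, s i = ∅) :
    (∃ hm : firstEmpty s < n, s ⟨firstEmpty s, hm⟩ = ∅) ∧
      ∀ i : Fin n, (i : ℕ) < firstEmpty s → s i ≠ ∅ := by
  obtain ⟨i, hi⟩ := h
  exact ⟨Nat.sInf_mem (s := {m | ∃ h : m < n, s ⟨m, h⟩ = ∅}) ⟨i, i.2, hi⟩,
    fun j hj hj' => Nat.notMem_of_lt_sInf hj ⟨j.2, hj'⟩⟩

lemma constCoef_snocChain_of_exists (q : Family d) {s : Fin n → Finset (Fin d)}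
    (h : ∃ i, s i = ∅) (t : Finset (Fin d)) : constCoef q (snocChain s t) = constCoef q s := by
  obtain ⟨⟨hm, h0⟩, hlt⟩ := firstEmpty_spec h
  have hfirst : firstEmpty (snocChain s t) = firstEmpty s := by
    refine firstEmpty_eq (hm.trans n.lt_succ_self) ?_ fun i hi => ?_
    · rw [snocChain_mk s t hm, h0]
    · have := snocChain_mk s t (hi.trans hm) i.2
      rw [Fin.eta] at this
      rw [this]
      exact hlt ⟨i, hi.trans hm⟩ hi
  rw [constCoef, hfirst, trunc_snocChain s t hm.le, constCoef]

/-- The appended set is the first empty one, so a new constant is created here: the value at the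
origin of the current derivative. -/
lemma constCoef_snocChain_of_forall (q : Family d) {s : Fin n → Finset (Fin d)}
    (h : ∀ i, s i ≠ ∅) : constCoef q (snocChain s ∅) = q n s 0 := by
  have hfirst : firstEmpty (snocChain s ∅) = n := by
    refine firstEmpty_eq n.lt_succ_self (snocChain_last s ∅) fun i hi => ?_
    have := snocChain_mk s ∅ hi i.2
    rw [Fin.eta] at this
    rw [this]
    exact h _
  rw [constCoef, hfirst, trunc_snocChain s ∅ le_rfl, trunc_self]

lemma ne_empty_of_last_nonempty {s : Fin (n + 1) → Finset (Fin d)} (hs : s ∈ chains d (n + 1))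
    (h : (s (Fin.last n)).Nonempty) (i : Fin (n + 1)) : s i ≠ ∅ :=
  (h.mono (mem_chains.1 hs (Fin.le_last i))).ne_empty

end Chains

/-! ### Edge factors of chains -/

section EdgeFactors

variable {d n : ℕ}

/-- The spline `φ_0^j(x(A))`. -/
noncomputable def edgeSpline (j : ℕ) (A : Finset (Fin d)) (x : Fin d → ℝ) : ℝ :=
  spline j 0 (sub A x)

lemma phiBar_eq (s : Fin (n + 1) → Finset (Fin d)) (x : Fin d → ℝ) :
    phiBar s x = ∏ j : Fin n, if (s j.castSucc).Nonempty then
      edgeSpline (j + 1) (s j.castSucc \ s j.succ) x else 1 :=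
  Finset.prod_filter _ _

lemma phiBar_snocChain (s : Fin (n + 1) → Finset (Fin d)) (t : Finset (Fin d)) (x : Fin d → ℝ) :
    phiBar (snocChain s t) x = phiBar s x * if (s (Fin.last n)).Nonempty then
      edgeSpline (n + 1) (s (Fin.last n) \ t) x else 1 := by
  simp only [phiBar_eq]
  rw [Fin.prod_univ_castSucc]
  simp only [Fin.succ_castSucc, snocChain_castSucc, Fin.succ_last, snocChain_last, Fin.val_castSucc,
    Fin.val_last]

/-- The edge factor of a chain is that of its part up to the first empty set. -/
lemma phiBar_trunc_firstEmpty {s : Fin (n + 1) → Finset (Fin d)} (hs : s ∈ chains d (n + 1))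
    (h : s (Fin.last n) = ∅) (x : Fin d → ℝ) :
    phiBar (trunc s (firstEmpty s + 1)) x = phiBar s x := by
  obtain ⟨⟨hm, h0⟩, hlt⟩ := firstEmpty_spec ⟨_, h⟩
  set m := firstEmpty s
  let S : ℕ → Finset (Fin d) := fun j => if h : j < n + 1 then s ⟨j, h⟩ else ∅
  let G : ℕ → ℝ := fun j => if (S j).Nonempty then edgeSpline (j + 1) (S j \ S (j + 1)) x else 1
  have h1 : phiBar s x = ∏ j ∈ Finset.range n, G j := by
    rw [phiBar_eq, Finset.prod_range]
    refine Finset.prod_congr rfl fun j _ => ?_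
    simp only [G, S, dif_pos (j.2.trans n.lt_succ_self), dif_pos (Nat.succ_lt_succ j.2)]
    rfl
  have h2 : phiBar (trunc s (m + 1)) x = ∏ j ∈ Finset.range m, G j := by
    rw [phiBar_eq, Finset.prod_range]
    exact Finset.prod_congr rfl fun j _ => rfl
  rw [h1, h2]
  refine Finset.prod_subset (Finset.range_subset_range.2 (Nat.lt_succ_iff.1 hm)) fun j hj hj' => ?_
  rw [Finset.mem_range] at hj hj'
  refine if_neg ?_
  -- From index `m` on the chain is empty by monotonicity, so the remaining factors are 1.
  have : S j ⊆ ∅ := by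
    rw [← h0]
    simp only [S, dif_pos (hj.trans n.lt_succ_self)]
    exact mem_chains.1 hs (not_lt.1 hj')
  rw [Finset.subset_empty.1 this]
  exact Finset.not_nonempty_empty

end EdgeFactors

/-! ### The inductive representation of `Q` -/

section Representation

variable {d n k : ℕ}

/-- The `n`-th order primitive of the difference of the section of `g` on the face of `t`. -/
noncomputable def facePart (n : ℕ) (t : Finset (Fin d)) (g : (Fin d → ℝ) → ℝ) (x : Fin d → ℝ) : ℝ :=
  primitive n (fun u => gdiff (sect t g) 0 u) (sub t x)

/-- The factor of `φ̄_s(x)` in the representation of order `n`. -/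
noncomputable def chainTerm (q : Family d) (s : Fin (n + 1) → Finset (Fin d)) (x : Fin d → ℝ) : ℝ :=
  if s (Fin.last n) = ∅ then constCoef q s else facePart n (s (Fin.last n)) (q n (trunc s n)) x

/-- The differences of the section of `g` on the face of `t` are bounded and measurable. -/
def HasBddMeasDiff (t : Finset (Fin d)) (g : (Fin d → ℝ) → ℝ) : Prop :=
  IsBddMeas fun u => gdiff (sect t g) 0 u

lemma sub_mem_Icc (s : Finset (Fin d)) {x : Fin d → ℝ} (hx : x ∈ Set.Icc (0 : Fin d → ℝ) 1) :
    sub s x ∈ Set.Icc (0 : s → ℝ) 1 :=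
  ⟨fun i => hx.1 i, fun i => hx.2 i⟩

lemma gdiff_sect_empty (g : (Fin d → ℝ) → ℝ) (u : (∅ : Finset (Fin d)) → ℝ) :
    gdiff (sect ∅ g) 0 u = g 0 := by
  have h0 : ∀ v : (∅ : Finset (Fin d)) → ℝ, zeroExt ∅ v = 0 := fun v => by
    funext i
    simp [zeroExt]
  have hT : ∀ T : Finset (∅ : Finset (Fin d)), T.card = 0 := fun T => by
    rw [Finset.card_eq_zero, Finset.eq_empty_of_isEmpty T]
  simp [gdiff_eq_sum_corner, sect, h0, hT]

/-- In dimension zero integration over a box is evaluation at the only point, so the convention for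
empty sets agrees with the general formula. -/
lemma facePart_empty (n : ℕ) (g : (Fin d → ℝ) → ℝ) (x : Fin d → ℝ) : facePart n ∅ g x = g 0 := by
  have hx : sub ∅ x ∈ Set.Icc (0 : (∅ : Finset (Fin d)) → ℝ) 1 :=
    ⟨fun i => isEmptyElim i, fun i => isEmptyElim i⟩
  have h := primitive_sum {()} (fun _ => g 0) (f := fun _ _ => (1 : ℝ))
    (fun _ _ => isBddMeas_const 1) n hx
  simp only [Finset.sum_singleton, mul_one] at h
  simp only [facePart, gdiff_sect_empty]
  rw [h, primitive_one n hx.1, spline_eq_prod]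
  simp

lemma IsRNDeriv.gdiff_eq {ι : Type*} [Fintype ι] {f g : (ι → ℝ) → ℝ} (h : IsRNDeriv f g)
    {u : ι → ℝ} (hu : u ∈ Set.Icc (0 : ι → ℝ) 1) : gdiff f 0 u = ∫ y in box 0 u, g y := by
  rw [← h.2.1 0 u le_rfl hu.1 hu.2, withDensityᵥ_apply h.1 (measurableSet_box 0 u),
    Measure.restrict_restrict (measurableSet_box 0 u),
    Set.inter_eq_left.2 (box_mono le_rfl hu.2)]

lemma IsDerivFamily.isGeneratedBy {Q : (Fin d → ℝ) → ℝ} {q : Family d} (hq : IsDerivFamily k Q q)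
    {s : Fin (k + 1) → Finset (Fin d)} (hs : s ∈ chains d (k + 1))
    (hne : (s (Fin.last k)).Nonempty) : IsGeneratedBy (dMeasure (topSect q s)) (topSect q s) :=
  isGeneratedBy_dMeasure (hq.cadlag s hs hne) (hq.finite s hs hne)

/-- The generated measure comes from the density below order `k`, and from the cadlag and variation
conditions at order `k`. -/
lemma IsDerivFamily.hasBddMeasDiff {Q : (Fin d → ℝ) → ℝ} {q : Family d}
    (hq : IsDerivFamily k Q q) (hn : n ≤ k) {s : Fin (n + 1) → Finset (Fin d)}
    (hs : s ∈ chains d (n + 1)) (hne : (s (Fin.last n)).Nonempty) :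
    HasBddMeasDiff (s (Fin.last n)) (q n (trunc s n)) := by
  rcases hn.lt_or_eq with h | rfl
  · exact (hq.deriv n h s hs hne).2.isBddMeas
  · exact (hq.isGeneratedBy hs hne).isBddMeas

/-- The primitives of a function on a face are sums over the subfaces. -/
lemma primitive_sect_eq_sum (j : ℕ) (S : Finset (Fin d)) (g : (Fin d → ℝ) → ℝ)
    (hg : ∀ t ⊆ S, t.Nonempty → HasBddMeasDiff t g) {x : Fin d → ℝ}
    (hx : x ∈ Set.Icc (0 : Fin d → ℝ) 1) :
    primitive j (sect S g) (sub S x) =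
      ∑ t ∈ S.powerset, edgeSpline j (S \ t) x * facePart j t g x := by
  have hsub : ∀ t (ht : t ⊆ S) (y : S → ℝ), sub t (zeroExt S y) = fun i : t => y ⟨i, ht i.2⟩ := by
    intro t ht y
    funext i
    simp [sub, zeroExt, ht i.2]
  have hbdd : ∀ t ∈ S.powerset, IsBddMeas fun y : S → ℝ =>
      gdiff (sect t g) 0 (sub t (zeroExt S y)) := by
    intro t ht
    have ht' := Finset.mem_powerset.1 ht
    rcases t.eq_empty_or_nonempty with rfl | hne
    · simp only [gdiff_sect_empty]
      exact isBddMeas_const _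
    · simp only [hsub t ht']
      exact (hg t ht' hne).comp fun i : t => (⟨i, ht' i.2⟩ : S)
  have h1 : sect S g = fun y => ∑ t ∈ S.powerset,
      (1 : ℝ) * gdiff (sect t g) 0 (sub t (zeroExt S y)) := by
    funext y
    simp only [one_mul]
    exact sect_eq_sum_gdiff g S y
  rw [h1, primitive_sum S.powerset (fun _ => 1) hbdd j (sub_mem_Icc S hx)]
  refine Finset.sum_congr rfl fun t ht => ?_
  have ht' := Finset.mem_powerset.1 ht
  let e : t ⊕ (S \ t : Finset (Fin d)) ≃ S := Equiv.ofBijective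
    (Sum.elim (fun i => ⟨i, ht' i.2⟩) fun i => ⟨i, (Finset.mem_sdiff.1 i.2).1⟩) (by
      constructor
      · rintro (a | a) (b | b) hab
        · have : (a : Fin d) = b := congrArg (fun i : S => (i : Fin d)) hab
          exact congrArg Sum.inl (Subtype.ext this)
        · have : (a : Fin d) = b := congrArg Subtype.val hab
          exact absurd (this ▸ a.2) (Finset.mem_sdiff.1 b.2).2
        · have : (a : Fin d) = b := congrArg Subtype.val hab
          exact absurd (this ▸ b.2) (Finset.mem_sdiff.1 a.2).2
        · have : (a : Fin d) = b := congrArg (fun i : S => (i : Fin d)) hab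
          exact congrArg Sum.inr (Subtype.ext this)
      · rintro ⟨i, hi⟩
        by_cases hit : i ∈ t
        · exact ⟨.inl ⟨i, hit⟩, rfl⟩
        · exact ⟨.inr ⟨i, Finset.mem_sdiff.2 ⟨hi, hit⟩⟩, rfl⟩)
  -- The difference over `t` ignores the coordinates in `S \ t`, which integrate to the edge spline.
  have h2 := primitive_mul e j (fun u => gdiff (sect t g) 0 u) (fun _ => 1) (sub S x)
  simp only [mul_one] at h2
  rw [primitive_one j (x := fun i => sub S x (e (Sum.inr i))) fun i => hx.1 _] at h2
  simp only [hsub t ht', one_mul]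
  rw [mul_comm]
  exact h2

/-- The term of a chain in the representation of order `n` is the sum over all extensions of the
chain of the terms in the representation of order `n + 1`. -/
lemma chainTerm_eq_sum {Q : (Fin d → ℝ) → ℝ} {q : Family d} (hq : IsDerivFamily k Q q) (hn : n < k)
    {s : Fin (n + 1) → Finset (Fin d)} (hs : s ∈ chains d (n + 1)) {x : Fin d → ℝ}
    (hx : x ∈ Set.Icc (0 : Fin d → ℝ) 1) :
    chainTerm q s x = ∑ t ∈ (s (Fin.last n)).powerset,
      (if (s (Fin.last n)).Nonempty then edgeSpline (n + 1) (s (Fin.last n) \ t) x else 1) *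
        chainTerm q (snocChain s t) x := by
  rcases (s (Fin.last n)).eq_empty_or_nonempty with h0 | hne
  -- A chain that has reached the empty set has one extension, with edge factor 1 and the same
  -- constant.
  · simp only [h0, Finset.powerset_empty, Finset.sum_singleton, Finset.not_nonempty_empty, if_false,
      one_mul]
    rw [chainTerm, if_pos h0, chainTerm, if_pos (snocChain_last s ∅),
      constCoef_snocChain_of_exists q ⟨_, h0⟩]
  · have hrn := hq.deriv n hn s hs hne
    have hterm : ∀ t ⊆ s (Fin.last n),
        chainTerm q (snocChain s t) x = facePart (n + 1) t (q (n + 1) s) x := by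
      intro t ht
      rw [chainTerm, snocChain_last, trunc_snocChain s t le_rfl, trunc_self]
      rcases t.eq_empty_or_nonempty with rfl | htne
      · rw [if_pos rfl, facePart_empty,
          constCoef_snocChain_of_forall q (ne_empty_of_last_nonempty hs hne)]
      · rw [if_neg htne.ne_empty]
    have hx' := sub_mem_Icc (s (Fin.last n)) hx
    -- The difference becomes the integral of the density, the order of the primitive rises by one,
    -- and the density is expanded over subfaces. The choice of version is immaterial: the expansion
    -- is a pointwise identity for the given one.
    rw [chainTerm, if_neg hne.ne_empty, facePart,
      primitive_congr n hx'.1 fun y hy => hrn.gdiff_eq ⟨hy.1, hy.2.trans hx'.2⟩,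
      primitive_setIntegral, primitive_sect_eq_sum (n + 1) _ _ ?_ hx]
    · refine Finset.sum_congr rfl fun t ht => ?_
      rw [if_pos hne, hterm t (Finset.mem_powerset.1 ht)]
    · intro t ht htne
      have := hq.hasBddMeasDiff (n := n + 1) hn (snocChain_mem_chains.2 ⟨hs, ht⟩)
        (by rwa [snocChain_last])
      rwa [snocChain_last, trunc_snocChain s t le_rfl, trunc_self] at this

/-- The representation of order zero. -/
lemma eq_sum_chainTerm_zero {Q : (Fin d → ℝ) → ℝ} {q : Family d} (hq : IsDerivFamily k Q q)
    {x : Fin d → ℝ} (hx : x ∈ Set.Icc (0 : Fin d → ℝ) 1) :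
    Q x = ∑ s ∈ chains d 1, phiBar s x * chainTerm q s x := by
  let F : (Fin d → ℝ) → ℝ := q 0 fun i => i.elim0
  have hF : ∀ s : Fin 0 → Finset (Fin d), q 0 s = F := fun s => by
    rw [Subsingleton.elim s]
  have hz : zeroExt Finset.univ (sub Finset.univ x) = x := by
    funext i
    simp [zeroExt, sub]
  have h1 : Q x = sect Finset.univ F (sub Finset.univ x) := by
    rw [sect, hz]
    exact (hq.zero _ x hx).symm
  rw [h1, sect_eq_sum_gdiff, hz]
  refine Finset.sum_bij' (fun t _ => fun _ => t) (fun s _ => s 0) (fun t _ => ?_) (fun s _ => ?_)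
    (fun t _ => rfl) (fun s _ => ?_) fun t _ => ?_
  · exact mem_chains.2 antitone_const
  · exact Finset.mem_powerset.2 (Finset.subset_univ _)
  · funext i
    rw [Subsingleton.elim i 0]
  · rw [phiBar_eq, Finset.univ_eq_empty, Finset.prod_empty, one_mul, chainTerm]
    rcases t.eq_empty_or_nonempty with rfl | hne
    · rw [if_pos rfl, gdiff_sect_empty, constCoef,
        firstEmpty_eq (m := 0) zero_lt_one rfl (fun i hi => absurd hi (Nat.not_lt_zero _)), hF]
    · rw [if_neg hne.ne_empty, hF]
      rfl

theorem eq_sum_chainTerm {Q : (Fin d → ℝ) → ℝ} {q : Family d} (hq : IsDerivFamily k Q q)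
    (hn : n ≤ k) {x : Fin d → ℝ} (hx : x ∈ Set.Icc (0 : Fin d → ℝ) 1) :
    Q x = ∑ s ∈ chains d (n + 1), phiBar s x * chainTerm q s x := by
  induction n with
  | zero => exact eq_sum_chainTerm_zero hq hx
  | succ n ih =>
    rw [ih (Nat.le_of_succ_le hn), sum_chains_succ]
    refine Finset.sum_congr rfl fun s hs => ?_
    rw [chainTerm_eq_sum hq hn hs hx, Finset.mul_sum]
    refine Finset.sum_congr rfl fun t _ => ?_
    rw [phiBar_snocChain, mul_assoc]

lemma IsDerivFamily.primitive_tildeQ {Q : (Fin d → ℝ) → ℝ} {q : Family d}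
    (hq : IsDerivFamily k Q q) {s : Fin (k + 1) → Finset (Fin d)} (hs : s ∈ chains d (k + 1))
    (hne : (s (Fin.last k)).Nonempty) {x : Fin d → ℝ} (hx : x ∈ Set.Icc (0 : Fin d → ℝ) 1) :
    primitive k (tildeQ q s) (sub (s (Fin.last k)) x) = chainTerm q s x := by
  have hx' := sub_mem_Icc (s (Fin.last k)) hx
  rw [chainTerm, if_neg hne.ne_empty]
  refine primitive_congr k hx'.1 fun u hu => ?_
  exact (hq.isGeneratedBy hs hne).1 0 u le_rfl hu.1 (hu.2.trans hx'.2)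

lemma IsDerivFamily.splineInt_eq {Q : (Fin d → ℝ) → ℝ} {q : Family d}
    (hq : IsDerivFamily k Q q) {s : Fin (k + 1) → Finset (Fin d)} (hs : s ∈ chains d (k + 1))
    (hne : (s (Fin.last k)).Nonempty) {x : Fin d → ℝ} (hx : x ∈ Set.Icc (0 : Fin d → ℝ) 1)
    {B : Set (s (Fin.last k) → ℝ)} (hB : MeasurableSet B) (hB1 : B ⊆ box 0 1)
    (hBx : box 0 (sub (s (Fin.last k)) x) ⊆ B) : splineInt q s B x = chainTerm q s x := by
  rw [← hq.primitive_tildeQ hs hne hx]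
  exact vectorIntegral_spline _ k (sub_mem_Icc _ hx) hB hB1 hBx

end Representation

end KSpline

theorem mainTheorem1 {d k : ℕ} (hk : 1 ≤ k) (Q : (Fin d → ℝ) → ℝ) (hQ : Q ∈ smoothClass d k)
    (q : Family d) (hq : IsDerivFamily k Q q) :
    -- every section of a top-order derivative generates a (unique) signed measure
    (∀ s ∈ chains d (k + 1), (s (Fin.last k)).Nonempty →
      IsGeneratedBy (dMeasure (topSect q s)) (topSect q s)) ∧
    -- spline representation, with the convention for chains that reach the empty set
    (∀ x ∈ Set.Icc (0 : Fin d → ℝ) 1,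
      Q x = ∑ s ∈ chains d (k + 1),
        phiBar s x * splinePart q s (box 0 (sub (s (Fin.last k)) x)) x) ∧
    (∀ x ∈ Set.Icc (0 : Fin d → ℝ) 1,
      Q x = ∑ s ∈ chains d (k + 1), phiBar s x * splinePart q s (box 0 1) x) ∧
    -- the same with the constant terms displayed
    (∀ x ∈ Set.Icc (0 : Fin d → ℝ) 1,
      Q x = (∑ s ∈ chains d (k + 1) with s (Fin.last k) = ∅,
          phiBar (trunc s (firstEmpty s + 1)) x * constCoef q s) +
        ∑ s ∈ chains d (k + 1) with s (Fin.last k) ≠ ∅,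
          phiBar s x * splineInt q s (box 0 1) x) ∧
    -- representation by `k`-th order primitives
    (∀ x ∈ Set.Icc (0 : Fin d → ℝ) 1,
      Q x = ∑ s ∈ chains d (k + 1), phiBar s x * primPart q s x) ∧
    (∀ x ∈ Set.Icc (0 : Fin d → ℝ) 1,
      Q x = (∑ s ∈ chains d (k + 1) with s (Fin.last k) = ∅,
          phiBar (trunc s (firstEmpty s + 1)) x * constCoef q s) +
        ∑ s ∈ chains d (k + 1) with s (Fin.last k) ≠ ∅,
          phiBar s x * primitive k (tildeQ q s) (sub (s (Fin.last k)) x)) ∧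
    -- the `L₁`-norm of the coefficients is the `k`-th order sectional variation norm
    (∑ s ∈ chains d (k + 1) with s (Fin.last k) = ∅, ENNReal.ofReal |constCoef q s|) +
        ∑ s ∈ chains d (k + 1) with s (Fin.last k) ≠ ∅,
          (dMeasure (topSect q s)).totalVariation (box 0 1) =
      sectVarNorm k q := by
  have hbox : ∀ s : Fin (k + 1) → Finset (Fin d), ∀ x ∈ Set.Icc (0 : Fin d → ℝ) 1,
      box 0 (sub (s (Fin.last k)) x) ⊆ box 0 1 := fun s x hx =>
    box_mono le_rfl (sub_mem_Icc _ hx).2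
  have hspline : ∀ s ∈ chains d (k + 1), s (Fin.last k) ≠ ∅ → ∀ x ∈ Set.Icc (0 : Fin d → ℝ) 1,
      splineInt q s (box 0 1) x = chainTerm q s x := fun s hs hne x hx =>
    hq.splineInt_eq hs (Finset.nonempty_iff_ne_empty.2 hne) hx (measurableSet_box 0 1) subset_rfl
      (hbox s x hx)
  have hprim : ∀ s ∈ chains d (k + 1), s (Fin.last k) ≠ ∅ → ∀ x ∈ Set.Icc (0 : Fin d → ℝ) 1,
      primitive k (tildeQ q s) (sub (s (Fin.last k)) x) = chainTerm q s x := fun s hs hne x hx =>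
    hq.primitive_tildeQ hs (Finset.nonempty_iff_ne_empty.2 hne) hx
  -- Both displayed forms follow from one splitting of the sum, with `c` the spline integral or the
  -- primitive; chains ending in the empty set only have their edge factor shortened.
  have hsplit : ∀ x ∈ Set.Icc (0 : Fin d → ℝ) 1, ∀ c : (Fin (k + 1) → Finset (Fin d)) → ℝ,
      (∀ s ∈ chains d (k + 1), s (Fin.last k) ≠ ∅ → c s = chainTerm q s x) →
      Q x = (∑ s ∈ chains d (k + 1) with s (Fin.last k) = ∅,
          phiBar (trunc s (firstEmpty s + 1)) x * constCoef q s) +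
        ∑ s ∈ chains d (k + 1) with s (Fin.last k) ≠ ∅, phiBar s x * c s := by
    intro x hx c hc
    rw [eq_sum_chainTerm hq le_rfl hx, Finset.sum_filter, Finset.sum_filter,
      ← Finset.sum_add_distrib]
    refine Finset.sum_congr rfl fun s hs => ?_
    by_cases h : s (Fin.last k) = ∅
    · rw [if_pos h, if_neg (not_not.2 h), add_zero, phiBar_trunc_firstEmpty hs h, chainTerm,
        if_pos h]
    · rw [if_neg h, if_pos h, zero_add, hc s hs h]
  refine ⟨fun s hs hne => hq.isGeneratedBy hs hne, fun x hx => ?_, fun x hx => ?_,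
    fun x hx => hsplit x hx _ fun s hs hne => hspline s hs hne x hx, fun x hx => ?_,
    fun x hx => hsplit x hx _ fun s hs hne => hprim s hs hne x hx, ?_⟩
  · rw [eq_sum_chainTerm hq le_rfl hx]
    refine Finset.sum_congr rfl fun s hs => ?_
    by_cases h : s (Fin.last k) = ∅
    · rw [chainTerm, splinePart, if_pos h, if_pos h]
    · rw [splinePart, if_neg h, hq.splineInt_eq hs (Finset.nonempty_iff_ne_empty.2 h) hx
        (measurableSet_box _ _) (hbox s x hx) subset_rfl]
  · rw [eq_sum_chainTerm hq le_rfl hx]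
    refine Finset.sum_congr rfl fun s hs => ?_
    by_cases h : s (Fin.last k) = ∅
    · rw [chainTerm, splinePart, if_pos h, if_pos h]
    · rw [splinePart, if_neg h, hspline s hs h x hx]
  · rw [eq_sum_chainTerm hq le_rfl hx]
    refine Finset.sum_congr rfl fun s hs => ?_
    by_cases h : s (Fin.last k) = ∅
    · rw [chainTerm, primPart, if_pos h, if_pos h]
    · rw [primPart, if_neg h, hprim s hs h x hx]
  · rw [sectVarNorm, Finset.sum_filter, Finset.sum_filter, ← Finset.sum_add_distrib]
    refine Finset.sum_congr rfl fun s hs => ?_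
    by_cases h : s (Fin.last k) = ∅
    · rw [if_pos h, if_neg (not_not.2 h), add_zero, if_pos h]
    · have hne := Finset.nonempty_iff_ne_empty.2 h
      rw [if_neg h, if_pos h, zero_add, if_neg h,
        totalVariation_dMeasure (hq.cadlag s hs hne) (hq.finite s hs hne)]
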